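/- **Setting.** Let $f$ be an increasing real function on $[0,1]$, let $d_0\in(0,1)$, and put $\theta_0=f(d_0)$. Let $p\in(0,1)$, $K>0$ and $\gamma>0$ be fixed. *Design and errors.* Let $\{x_{im}\}_{i=1}^m$, $m\ge 1$, be a triangular array of distinct, increasing design points in $[0,1]$ with empirical distribution functions $F_m$. Let $\varepsilon$ be a continuous random variable with mean $0$ and variance $\sigma^2>0$. On a probability space $(\Omega,\mathscr A,P)$ let there be given random errors $\varepsilon_{in},\varepsilon'_{in},\varepsilon''_{in}$ ($1\le i\le n$, $n\ge1$) such that for each $n$ the $3n$ errors of row $n$ are i.i.d. copies of $\varepsilon$ (no assumption is made on the dependence between different rows). *Two-stage estimator.* For a total budget $n$ let $n_1$ be $\lfloor np\rfloor$ if $n-\lfloor np\rfloor$ is even and $\lfloor np\rfloor+1$ otherwise, and let $n_2=(n-n_1)/2$. In the first stage observe $Y_i=f(x_{in_1})+\varepsilon_{in}$, $1\le i\le n_1$. Let $\hat f$ be the isotonic least squares regression of these data, extended from the design points to a right-continuous step function, and let $\hat d=\hat d^{(1)}_{n_1}=\inf\{t\in[0,1]:\hat f(t)\ge\theta_0\}$.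 Put $L=\hat d-Kn_1^{-\gamma}$ and $U=\hat d+Kn_1^{-\gamma}$. In the second stage observe $Y'_i=f(L)+\varepsilon'_{in}$ and $Y''_i=f(U)+\varepsilon''_{in}$, $1\le i\le n_2$. (If $L$ or $U$ lies outside $[0,1]$, the values of $f$ there are arbitrary.) Let $(\hat\beta_0,\hat\beta_1)$ be the intercept and slope of the least squares line through the data $(L,Y'_i),(U,Y''_i)$, and let $\tilde d^{(2)}_n=(\theta_0-\hat\beta_0)/\hat\beta_1$. *Bootstrap.* Given the data, draw $Y'^\star_1,\dots,Y'^\star_{n_2}$ and, independently, $Y''^\star_1,\dots,Y''^\star_{n_2}$ uniformly with replacement from $Y'_1,\dots,Y'_{n_2}$ and $Y''_1,\dots,Y''_{n_2}$, respectively. Let $(\hat\beta^\star_0,\hat\beta_1^\star)$ be the coefficients of the least squares line through $(L,Y'^\star_i),(U,Y''^\star_i)$, and let $\tilde d^{(2)\star}_n=(\theta_0-\hat\beta^\star_0)/\hat\beta^\star_1$. Write $P^\star$ for the conditional probability given the data. (A quotient with denominator $0$ is given the value $0$.) **Theorem.** Assume that $\gamma\in(0,1/3)$ and that: - ($f\in\mathscr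 F$) in a neighbourhood of $d_0$, $f$ has a positive and continuous first derivative and a uniformly bounded third derivative; - (A2) there is a distribution function $G$ whose Lebesgue density $g$ is positive and has a bounded first derivative on $[0,1]$, and a constant $c$ such that $\sup_{t\in[0,1]}|F_m(t)-G(t)|\le c\,m^{-1/2}$ for all $m\ge1$; - (A3) $f$ is differentiable on $[0,1]$, with $\inf_{[0,1]}f'>0$ and $\sup_{[0,1]}f'<\infty$; - (A4) $\mathbb E|\varepsilon|^q<\infty$ for all $q\in\mathbb N$. Let $C_2=\sigma/[f'(d_0)(1-p)^{1/2}]$ and let $Z_1$ be standard normal. Then, for $P$-almost every $\omega\in\Omega$, the conditional law under $P^\star$ of $n^{1/2}\bigl(\tilde d^{(2)\star}_n-\tilde d^{(2)}_n\bigr)$ converges weakly to the law of $C_2Z_1$ as $n\to\infty$, and $$\sup_{t\in\mathbb R}\Bigl|P^\star\bigl(n^{1/2}(\tilde d_n^{(2)\star}-\tilde d_n^{(2)})\le t\bigr)-P(C_2Z_1\le t)\Bigr|\longrightarrow 0 .$$ -/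

import Mathlib

open MeasureTheory ProbabilityTheory Filter Topology Set

noncomputable section

namespace TwoStage

/-! ## The regression function -/

/-- `f` is increasing on `[0,1]` and has a positive and continuous first derivative in a
neighbourhood of `d₀`. -/
structure InClassFZero (f : ℝ → ℝ) (d₀ : ℝ) : Prop where
  monotoneOn : MonotoneOn f (Icc 0 1)
  smooth_near : ∃ δ > 0,
    (∀ x ∈ Ioo (d₀ - δ) (d₀ + δ), DifferentiableAt ℝ f x ∧ 0 < deriv f x) ∧
    ContinuousOn (deriv f) (Ioo (d₀ - δ) (d₀ + δ))

/-- `f` is in the previous class, and its third derivative exists and is uniformly bounded in a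
neighbourhood of `d₀`. -/
structure InClassF (f : ℝ → ℝ) (d₀ : ℝ) : Prop extends InClassFZero f d₀ where
  third_deriv_bounded : ∃ δ > 0, ∃ M : ℝ, ∀ x ∈ Ioo (d₀ - δ) (d₀ + δ),
    DifferentiableAt ℝ f x ∧ DifferentiableAt ℝ (iteratedDeriv 1 f) x ∧
    DifferentiableAt ℝ (iteratedDeriv 2 f) x ∧ |iteratedDeriv 3 f x| ≤ M

/-- `f` is differentiable on `[0,1]` (one-sidedly at the end points), and its derivative is bounded
above and bounded away from zero there. -/
def HasBoundedSlope (f : ℝ → ℝ) : Prop :=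
  DifferentiableOn ℝ f (Icc 0 1) ∧
  ∃ a b : ℝ, 0 < a ∧ ∀ x ∈ Icc (0 : ℝ) 1,
    a ≤ derivWithin f (Icc 0 1) x ∧ derivWithin f (Icc 0 1) x ≤ b

/-! ## The design -/

/-- The empirical distribution function of the points `x 0, …, x (m - 1)`. -/
def empiricalCDF {m : ℕ} (x : Fin m → ℝ) (t : ℝ) : ℝ :=
  ((Finset.univ.filter fun i => x i ≤ t).card : ℝ) / m

/-- A triangular array (`x m` is the row of length `m`) of increasing, distinct design points of
`[0,1]`. -/
def IsDesignArray (x : (m : ℕ) → Fin m → ℝ) : Prop :=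
  ∀ m, StrictMono (x m) ∧ ∀ i, x m i ∈ Icc (0 : ℝ) 1

/-- There is a distribution function `G` (the one of the probability measure `ν`) whose Lebesgue
density `g` is positive and has a bounded first derivative on `[0,1]`, such that
`sup_{t ∈ [0,1]} |F_m t - G t| ≤ C m ^ (-1/2)` for the empirical distribution functions `F_m`
of the rows. -/
def IsRegularDesign (x : (m : ℕ) → Fin m → ℝ) : Prop :=
  ∃ (ν : Measure ℝ) (g : ℝ → ℝ), IsProbabilityMeasure ν ∧ Measurable g ∧ (∀ t, 0 ≤ g t) ∧
    ν = volume.withDensity (fun t => ENNReal.ofReal (g t)) ∧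
    (∀ t ∈ Icc (0 : ℝ) 1, 0 < g t) ∧
    DifferentiableOn ℝ g (Icc 0 1) ∧
    (∃ B : ℝ, ∀ t ∈ Icc (0 : ℝ) 1, |derivWithin g (Icc 0 1) t| ≤ B) ∧
    ∃ C : ℝ, ∀ m : ℕ, 0 < m → ∀ t ∈ Icc (0 : ℝ) 1,
      |empiricalCDF (x m) t - cdf ν t| ≤ C / Real.sqrt m

/-! ## The errors -/

/-- `μ` is the law of the generic error: a continuous law with mean `0` and variance
`σ ^ 2 > 0`. -/
structure IsErrorLaw (μ : Measure ℝ) (σ : ℝ) : Prop where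
  isProbabilityMeasure : IsProbabilityMeasure μ
  noAtoms : NullSingletonClass μ
  pos : 0 < σ
  integrable_sq : Integrable (fun z : ℝ => z ^ 2) μ
  mean_eq : ∫ z, z ∂μ = 0
  var_eq : ∫ z, z ^ 2 ∂μ = σ ^ 2

/-- All absolute moments of `μ` are finite. -/
def HasAllMoments (μ : Measure ℝ) : Prop :=
  ∀ q : ℕ, Integrable (fun z : ℝ => |z| ^ q) μ

/-- For every `n`, the `3 n` random variables `ε n i`, `ε' n i`, `ε'' n i`, `i < n`, are
independent copies of a random variable with law `μ`. Nothing is assumed about the dependence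
between different rows. -/
structure IsErrorArray {Ω : Type*} [MeasurableSpace Ω] (P : Measure Ω) (μ : Measure ℝ)
    (ε ε' ε'' : ℕ → ℕ → Ω → ℝ) : Prop where
  law : ∀ n, ∀ i < n, HasLaw (ε n i) μ P ∧ HasLaw (ε' n i) μ P ∧ HasLaw (ε'' n i) μ P
  indep : ∀ n, iIndepFun (fun j : Fin 3 × Fin n =>
    (![ε n, ε' n, ε'' n] j.1 : ℕ → Ω → ℝ) j.2) P

/-! ## Isotonic regression and the first-stage estimator -/

/-- `v` is an isotonic least squares fit of the responses `y` (listed in the order of the design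
points). -/
def IsIsotonicFit {m : ℕ} (y v : Fin m → ℝ) : Prop :=
  Monotone v ∧ ∀ u : Fin m → ℝ, Monotone u → ∑ i, (y i - v i) ^ 2 ≤ ∑ i, (y i - u i) ^ 2

theorem exists_isIsotonicFit {m : ℕ} (y : Fin m → ℝ) : ∃ v, IsIsotonicFit y v := by
  let S : Set (EuclideanSpace ℝ (Fin m)) := {v | ∀ i j : Fin m, i ≤ j → v i ≤ v j}
  have hne : S.Nonempty := ⟨0, fun i j _ => le_refl _⟩
  have hcl : IsClosed S := by
    have : S = ⋂ i, ⋂ j, ⋂ _ : i ≤ j, {v : EuclideanSpace ℝ (Fin m) | v i ≤ v j} := by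
      ext v; simp [S]
    rw [this]
    refine isClosed_iInter fun i => isClosed_iInter fun j => isClosed_iInter fun _ => ?_
    exact isClosed_le (by fun_prop) (by fun_prop)
  have hcv : Convex ℝ S := by
    intro v hv w hw a b ha hb _ i j hij
    have h1 := mul_le_mul_of_nonneg_left (hv i j hij) ha
    have h2 := mul_le_mul_of_nonneg_left (hw i j hij) hb
    simpa using add_le_add h1 h2
  obtain ⟨v, hv, hmin⟩ := exists_norm_eq_iInf_of_complete_convex hne hcl.isComplete hcv
    (WithLp.toLp 2 y)
  refine ⟨fun i => v i, fun i j hij => hv i j hij, fun u hu => ?_⟩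
  have hle : ‖WithLp.toLp 2 y - v‖ ≤ ‖WithLp.toLp 2 y - WithLp.toLp 2 u‖ := by
    rw [hmin]
    exact ciInf_le (f := fun w : S => ‖WithLp.toLp 2 y - (w : EuclideanSpace ℝ (Fin m))‖)
      ⟨0, by rintro _ ⟨w, rfl⟩; exact norm_nonneg _⟩ ⟨WithLp.toLp 2 u, fun i j hij => hu hij⟩
  have hsq := pow_le_pow_left₀ (norm_nonneg _) hle 2
  simpa [EuclideanSpace.norm_sq_eq] using hsq

/-- The fitted values of the isotonic regression of `y` (they are unique). -/
def isotonicFit {m : ℕ} (y : Fin m → ℝ) : Fin m → ℝ := (exists_isIsotonicFit y).choose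

/-- The isotonic regression estimate of the regression function: the right-continuous step
function, with jumps only at design points, that takes the isotonic fitted values at the design
points. (To the left of the first design point, it keeps the smallest fitted value.) -/
def isotonicRegression {m : ℕ} (x y : Fin m → ℝ) (t : ℝ) : ℝ :=
  open Classical in
  if ∃ i, x i ≤ t then ⨆ i : {i // x i ≤ t}, isotonicFit y i else ⨅ i, isotonicFit y i

/-- `inf {t ∈ [0,1] : g t ≥ θ}`; the infimum is taken in `[0,1]`, so that it is `1` when the set is
empty. -/
def levelInverse (g : ℝ → ℝ) (θ : ℝ) : ℝ :=
  sInf (insert 1 {t : ℝ | t ∈ Icc (0 : ℝ) 1 ∧ θ ≤ g t})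

/-! ## The two-stage estimator -/

/-- The first-stage sample size for a total budget `n`: `⌊n p⌋` or `⌊n p⌋ + 1`, whichever leaves an
even number of observations. -/
def firstSize (p : ℝ) (n : ℕ) : ℕ :=
  if Even (n - ⌊(n : ℝ) * p⌋₊) then ⌊(n : ℝ) * p⌋₊ else ⌊(n : ℝ) * p⌋₊ + 1

/-- The number `n₂` of second-stage observations at each of the two points. -/
def secondSize (p : ℝ) (n : ℕ) : ℕ := (n - firstSize p n) / 2

/-- The first-stage estimator of `d₀` for a total budget `n`, from the responses
`f (x i) + e i` at the design points of row `n₁`. Here `e` lists the first-stage errors. -/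
def firstEstimate (f : ℝ → ℝ) (d₀ p : ℝ) (x : (m : ℕ) → Fin m → ℝ) (n : ℕ) (e : ℕ → ℝ) : ℝ :=
  levelInverse
    (isotonicRegression (x (firstSize p n)) fun i => f (x (firstSize p n) i) + e i) (f d₀)

/-- The lower second-stage sampling point. -/
def lowerPoint (f : ℝ → ℝ) (d₀ p K γ : ℝ) (x : (m : ℕ) → Fin m → ℝ) (n : ℕ) (e : ℕ → ℝ) : ℝ :=
  firstEstimate f d₀ p x n e - K * (firstSize p n : ℝ) ^ (-γ)

/-- The upper second-stage sampling point. -/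
def upperPoint (f : ℝ → ℝ) (d₀ p K γ : ℝ) (x : (m : ℕ) → Fin m → ℝ) (n : ℕ) (e : ℕ → ℝ) : ℝ :=
  firstEstimate f d₀ p x n e + K * (firstSize p n : ℝ) ^ (-γ)

/-- The average of `k` numbers. -/
def mean {k : ℕ} (y : Fin k → ℝ) : ℝ := (∑ i, y i) / k

/-- Slope of the least squares line through the data `(L, y i)`, `(U, z i)`, `i < k`. -/
def lsSlope {k : ℕ} (L U : ℝ) (y z : Fin k → ℝ) : ℝ := (mean z - mean y) / (U - L)

/-- Intercept of the least squares line through the data `(L, y i)`, `(U, z i)`, `i < k`. -/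
def lsIntercept {k : ℕ} (L U : ℝ) (y z : Fin k → ℝ) : ℝ :=
  (mean y + mean z) / 2 - (L + U) / 2 * lsSlope L U y z

/-- The two formulas above do give the least squares line. -/
theorem ls_le {k : ℕ} (hk : 0 < k) {L U : ℝ} (h : L ≠ U) (y z : Fin k → ℝ) (b₀ b₁ : ℝ) :
    ∑ i, ((y i - lsIntercept L U y z - lsSlope L U y z * L) ^ 2 +
        (z i - lsIntercept L U y z - lsSlope L U y z * U) ^ 2) ≤
      ∑ i, ((y i - b₀ - b₁ * L) ^ 2 + (z i - b₀ - b₁ * U) ^ 2) := by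
  have hne : U - L ≠ 0 := sub_ne_zero.mpr h.symm
  have hL : lsIntercept L U y z + lsSlope L U y z * L = mean y := by
    unfold lsIntercept lsSlope; field_simp; ring
  have hU : lsIntercept L U y z + lsSlope L U y z * U = mean z := by
    unfold lsIntercept lsSlope; field_simp; ring
  have key : ∀ (w : Fin k → ℝ) (c : ℝ), ∑ i, (w i - mean w) ^ 2 ≤ ∑ i, (w i - c) ^ 2 := by
    intro w c
    have hk' : (k : ℝ) ≠ 0 := by positivity
    have hs : ∑ i, w i = k * mean w := by unfold mean; field_simp
    have e1 : ∀ a : ℝ, ∑ i, (w i - a) ^ 2 = ∑ i, w i ^ 2 - 2 * a * (k * mean w) + k * a ^ 2 := by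
      intro a
      rw [← hs, Finset.mul_sum, ← Finset.sum_sub_distrib]
      have : (k : ℝ) * a ^ 2 = ∑ _i : Fin k, a ^ 2 := by simp
      rw [this, ← Finset.sum_add_distrib]
      exact Finset.sum_congr rfl fun i _ => by ring
    rw [e1, e1]
    nlinarith [mul_nonneg (Nat.cast_nonneg (α := ℝ) k) (sq_nonneg (mean w - c))]
  simp only [sub_sub, hL, hU, Finset.sum_add_distrib]
  exact add_le_add (key y _) (key z _)

/-- The abscissa at which the least squares line reaches the level `θ`. -/
def lsInverse {k : ℕ} (θ L U : ℝ) (y z : Fin k → ℝ) : ℝ :=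
  (θ - lsIntercept L U y z) / lsSlope L U y z

/-- The second-stage responses at `L`; `e` and `e'` list the first-stage errors and the errors
at `L`. -/
def lowerResponse (f : ℝ → ℝ) (d₀ p K γ : ℝ) (x : (m : ℕ) → Fin m → ℝ) (n : ℕ) (e e' : ℕ → ℝ)
    (i : Fin (secondSize p n)) : ℝ :=
  f (lowerPoint f d₀ p K γ x n e) + e' i

/-- The second-stage responses at `U`; `e` and `e''` list the first-stage errors and the errors
at `U`. -/
def upperResponse (f : ℝ → ℝ) (d₀ p K γ : ℝ) (x : (m : ℕ) → Fin m → ℝ) (n : ℕ) (e e'' : ℕ → ℝ)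
    (i : Fin (secondSize p n)) : ℝ :=
  f (upperPoint f d₀ p K γ x n e) + e'' i

/-- The two-stage estimator of `d₀`. -/
def twoStageEstimate (f : ℝ → ℝ) (d₀ p K γ : ℝ) (x : (m : ℕ) → Fin m → ℝ) (n : ℕ)
    (e e' e'' : ℕ → ℝ) : ℝ :=
  lsInverse (f d₀) (lowerPoint f d₀ p K γ x n e) (upperPoint f d₀ p K γ x n e)
    (lowerResponse f d₀ p K γ x n e e') (upperResponse f d₀ p K γ x n e e'')

/-! ## The bootstrap -/

/-- The outcomes of the resampling step: `r (0, i)` and `r (1, i)` are the indices of the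
observations at `L` and at `U` that are drawn as the `i`-th bootstrap responses. -/
abbrev Resample (k : ℕ) : Type := Fin 2 × Fin k → Fin k

/-- The law of the resampling step, sampling with replacement: all indices are drawn independently
and uniformly. -/
def bootstrapMeasure (k : ℕ) : Measure (Resample k) :=
  Measure.pi fun _ => uniformOn (univ : Set (Fin k))

instance bootstrapMeasure_isProbabilityMeasure (k : ℕ) : IsProbabilityMeasure (bootstrapMeasure k) := by
  unfold bootstrapMeasure
  rcases Nat.eq_zero_or_pos k with rfl | hk
  · rw [Measure.pi_of_empty]
    infer_instance
  · have : Nonempty (Fin k) := ⟨⟨0, hk⟩⟩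
    have : IsProbabilityMeasure (uniformOn (univ : Set (Fin k))) :=
      isProbabilityMeasure_uniformOn finite_univ univ_nonempty
    infer_instance

/-- The bootstrapped two-stage estimator: the two-stage estimator (with the same `L` and `U`)
recomputed from the resampled second-stage responses. -/
def bootstrapEstimate (f : ℝ → ℝ) (d₀ p K γ : ℝ) (x : (m : ℕ) → Fin m → ℝ) (n : ℕ)
    (e e' e'' : ℕ → ℝ) (r : Resample (secondSize p n)) : ℝ :=
  lsInverse (f d₀) (lowerPoint f d₀ p K γ x n e) (upperPoint f d₀ p K γ x n e)
    (fun i => lowerResponse f d₀ p K γ x n e e' (r (0, i)))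
    (fun i => upperResponse f d₀ p K γ x n e e'' (r (1, i)))

/-- The bootstrapped root `√n (bootstrapped two-stage estimator - two-stage estimator)`. -/
def bootstrapRoot (f : ℝ → ℝ) (d₀ p K γ : ℝ) (x : (m : ℕ) → Fin m → ℝ) (n : ℕ)
    (e e' e'' : ℕ → ℝ) (r : Resample (secondSize p n)) : ℝ :=
  Real.sqrt n *
    (bootstrapEstimate f d₀ p K γ x n e e' e'' r - twoStageEstimate f d₀ p K γ x n e e' e'')

/-- The constant `σ / (f'(d₀) (1 - p) ^ (1/2))`. -/
def limitScale (f : ℝ → ℝ) (d₀ p σ : ℝ) : ℝ := σ / (deriv f d₀ * Real.sqrt (1 - p))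

end TwoStage

end

/-!
If `d̂` misses `d₀` by more than `2 h`, then the isotonic fit lies on the wrong side of `f d₀` on a
stretch of consecutive design points that fills an interval of length `h`. By optimality of the fit
the average of the data over the stretch lies on the wrong side too, whereas `f` differs from `f d₀`
by at least `a h` there; so the average of the errors has modulus at least `a h`. There are `O(n²)`
stretches, and the errors have moments of all orders; Markov's inequality and the Borel–Cantelli
lemma, which do not involve the dependence between rows, bound the error sums over all stretches by
`n ^ b` times the square root of their length, for any `b > 0`. For `h` of order `n ^ (-γ)` the
average is thus `O(n ^ (b - (1 - γ) / 2))`, which is smaller than `h` when `γ < 1 / 3`. Hence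
`n ^ γ (d̂ - d₀) → 0` almost surely.

Consequently `L` and `U` are asymptotically symmetric about `d₀` at the scale `n ^ (-γ)`, and the
slope of the least squares line tends to `f' d₀`. Fix a sample point. As `√n (U - L) → ∞`, the
bootstrapped root is asymptotically equivalent to the linear function `-(S₀ + S₁) / (2 f' d₀)` of
the scaled bootstrap errors `S₀` and `S₁` of the two means. These are sums of independent variables,
the sum of whose variances converges and the sum of whose third absolute moments tends to zero, so
their characteristic functions converge to those of a normal law. As this law has no atoms, the
distribution functions converge uniformly.
-/

namespace TwoStage

/-! ## Moments of sums of independent centered random variables -/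

/-- `X` is a family of independent, centered random variables whose absolute moments are finite,
the one of order `r` being bounded by `A r`. -/
structure IsCenteredFamily {Ω : Type*} [MeasurableSpace Ω] (P : Measure Ω) (A : ℕ → ℝ)
    {ι : Type*} (X : ι → Ω → ℝ) : Prop where
  indep : iIndepFun X P
  aemeasurable : ∀ i, AEMeasurable (X i) P
  integrable_pow : ∀ i r, Integrable (fun ω => |X i ω| ^ r) P
  mean_eq : ∀ i, ∫ ω, X i ω ∂P = 0
  moment_le : ∀ i r, ∫ ω, |X i ω| ^ r ∂P ≤ A r

/-- The constant in the moment bound `|𝔼 (∑_{i ∈ s} X i) ^ r| ≤ momentBound A r * |s| ^ (r / 2)` for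
centered families. The recursion comes from splitting off one summand of the sum by the binomial
theorem; the linear term vanishes. -/
noncomputable def momentBound (A : ℕ → ℝ) : ℕ → ℝ
  | 0 => 1
  | 1 => 0
  | r + 2 => ∑ j ∈ Finset.range (r + 1),
      |A (j + 2)| * momentBound A (r - j) * (r + 2).choose (j + 2)

theorem momentBound_nonneg (A : ℕ → ℝ) (r : ℕ) : 0 ≤ momentBound A r := by
  induction r using momentBound.induct with
  | case1 => simp [momentBound]
  | case2 => simp [momentBound]
  | case3 r ih =>
    rw [momentBound]
    exact Finset.sum_nonneg fun j _ => by have := ih j; positivity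

section Moments

variable {Ω : Type*} [MeasurableSpace Ω] {P : Measure Ω} {A : ℕ → ℝ}
  {ι : Type*} {X : ι → Ω → ℝ}

theorem memLp_nat_of_integrable_pow {Y : Ω → ℝ} (hY : AEMeasurable Y P) (r : ℕ)
    (h : Integrable (fun ω => |Y ω| ^ r) P) : MemLp Y r P := by
  rcases Nat.eq_zero_or_pos r with rfl | hr
  · simpa using hY.aestronglyMeasurable
  · refine (integrable_norm_rpow_iff hY.aestronglyMeasurable (by exact_mod_cast hr.ne')
      (by simp)).1 ?_
    simpa using h

namespace IsCenteredFamily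

theorem abs_integral_pow_le (h : IsCenteredFamily P A X) (a : ι) (j : ℕ) :
    |∫ ω, X a ω ^ j ∂P| ≤ A j := by
  refine abs_integral_le_integral_abs.trans ?_
  simpa using h.moment_le a j

theorem indepFun_pow_sum_pow (h : IsCenteredFamily P A X) {s : Finset ι} {a : ι} (ha : a ∉ s)
    (j k : ℕ) : IndepFun (fun ω => X a ω ^ j) (fun ω => (∑ i ∈ s, X i ω) ^ k) P := by
  have hind : IndepFun (X a) (∑ i ∈ s, X i) P :=
    (h.indep.indepFun_finsetSum_of_notMem₀ h.aemeasurable ha).symm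
  convert hind.comp (φ := fun z : ℝ => z ^ j) (ψ := fun z : ℝ => z ^ k) (by fun_prop) (by fun_prop)
    using 1 <;> (ext ω; simp)

variable [IsProbabilityMeasure P]

theorem integrable_sum_pow (h : IsCenteredFamily P A X) (s : Finset ι) (r : ℕ) :
    Integrable (fun ω => (∑ i ∈ s, X i ω) ^ r) P := by
  have hLp : MemLp (fun ω => ∑ i ∈ s, X i ω) r P :=
    memLp_finsetSum s fun i _ =>
      memLp_nat_of_integrable_pow (h.aemeasurable i) r (h.integrable_pow i r)
  refine hLp.integrable_norm_pow'.mono' (hLp.1.pow r) (ae_of_all _ fun ω => ?_)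
  simp

theorem integral_sum_insert_pow [DecidableEq ι] (h : IsCenteredFamily P A X)
    {s : Finset ι} {a : ι} (ha : a ∉ s) (r : ℕ) :
    ∫ ω, (∑ i ∈ insert a s, X i ω) ^ r ∂P = ∑ j ∈ Finset.range (r + 1),
      (∫ ω, X a ω ^ j ∂P) * (∫ ω, (∑ i ∈ s, X i ω) ^ (r - j) ∂P) * r.choose j := by
  have hXint (j : ℕ) : Integrable (fun ω => X a ω ^ j) P := by
    simpa using h.integrable_sum_pow {a} j
  have hinteg (j : ℕ) :
      Integrable (fun ω => X a ω ^ j * (∑ i ∈ s, X i ω) ^ (r - j) * (r.choose j : ℝ)) P :=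
    ((h.indepFun_pow_sum_pow ha j (r - j)).integrable_mul (hXint j)
      (h.integrable_sum_pow s _)).mul_const _
  simp only [Finset.sum_insert ha, add_pow]
  rw [integral_finsetSum _ fun j _ => hinteg j]
  refine Finset.sum_congr rfl fun j _ => ?_
  rw [integral_mul_const, (h.indepFun_pow_sum_pow ha j (r - j)).integral_fun_mul_eq_mul_integral
    (hXint j).aestronglyMeasurable (h.integrable_sum_pow s _).aestronglyMeasurable]

theorem integral_sum_insert_pow_add_two [DecidableEq ι] (h : IsCenteredFamily P A X)
    {s : Finset ι} {a : ι} (ha : a ∉ s) (r : ℕ) :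
    ∫ ω, (∑ i ∈ insert a s, X i ω) ^ (r + 2) ∂P =
      ∫ ω, (∑ i ∈ s, X i ω) ^ (r + 2) ∂P + ∑ j ∈ Finset.range (r + 1),
        (∫ ω, X a ω ^ (j + 2) ∂P) * (∫ ω, (∑ i ∈ s, X i ω) ^ (r - j) ∂P) *
          (r + 2).choose (j + 2) := by
  rw [h.integral_sum_insert_pow ha, Finset.sum_range_succ', Finset.sum_range_succ', add_assoc,
    add_comm]
  simp [h.mean_eq a]

theorem abs_integral_sum_pow_le (h : IsCenteredFamily P A X) (r : ℕ) (s : Finset ι) :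
    |∫ ω, (∑ i ∈ s, X i ω) ^ r ∂P| ≤ momentBound A r * (s.card : ℝ) ^ (r / 2) := by
  classical
  induction r using momentBound.induct generalizing s with
  | case1 => simp [momentBound]
  | case2 =>
    have hinteg (i : ι) : Integrable (X i) P := by simpa using h.integrable_sum_pow {i} 1
    simp [momentBound, integral_finsetSum _ fun i _ => hinteg i, h.mean_eq]
  | case3 r ih =>
    rw [show (r + 2) / 2 = r / 2 + 1 by omega]
    induction s using Finset.induction_on with
    | empty => simp
    | insert a s ha ihs =>
      set N : ℝ := (s.card : ℝ)
      have hN : 0 ≤ N := Nat.cast_nonneg _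
      have hrest : |∑ j ∈ Finset.range (r + 1), (∫ ω, X a ω ^ (j + 2) ∂P) *
          (∫ ω, (∑ i ∈ s, X i ω) ^ (r - j) ∂P) * (r + 2).choose (j + 2)| ≤
          momentBound A (r + 2) * (N + 1) ^ (r / 2) := by
        rw [momentBound, Finset.sum_mul]
        refine (Finset.abs_sum_le_sum_abs _ _).trans (Finset.sum_le_sum fun j _ => ?_)
        have hX : |∫ ω, X a ω ^ (j + 2) ∂P| ≤ |A (j + 2)| :=
          (h.abs_integral_pow_le a _).trans (le_abs_self _)
        have hpow : N ^ ((r - j) / 2) ≤ (N + 1) ^ (r / 2) :=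
          (pow_le_pow_left₀ hN (by linarith) _).trans
            (pow_le_pow_right₀ (by linarith) (by omega))
        have hS := (ih j s).trans (mul_le_mul_of_nonneg_left hpow (momentBound_nonneg A _))
        rw [abs_mul, abs_mul, Nat.abs_cast, mul_right_comm _ _ ((N + 1) ^ _), mul_assoc |A _|]
        gcongr
      rw [h.integral_sum_insert_pow_add_two ha, Finset.card_insert_of_notMem ha, Nat.cast_succ]
      calc _ ≤ momentBound A (r + 2) * N ^ (r / 2 + 1) +
            momentBound A (r + 2) * (N + 1) ^ (r / 2) :=
          (abs_add_le _ _).trans (add_le_add ihs hrest)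
        _ = momentBound A (r + 2) * (N * N ^ (r / 2) + (N + 1) ^ (r / 2)) := by ring
        _ ≤ momentBound A (r + 2) * (N * (N + 1) ^ (r / 2) + (N + 1) ^ (r / 2)) := by
          have := momentBound_nonneg A (r + 2)
          gcongr
          linarith
        _ = _ := by ring

theorem measureReal_lt_abs_sum_le (h : IsCenteredFamily P A X) (q : ℕ) (s : Finset ι) {t : ℝ}
    (ht : 0 < t) :
    P.real {ω | t * √s.card < |∑ i ∈ s, X i ω|} ≤ momentBound A (2 * q) / t ^ (2 * q) := by
  rcases s.eq_empty_or_nonempty with rfl | hs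
  · simpa using div_nonneg (momentBound_nonneg A (2 * q)) (pow_nonneg ht.le _)
  have hcard : (0 : ℝ) < s.card := by exact_mod_cast hs.card_pos
  have hsub : {ω | t * √s.card < |∑ i ∈ s, X i ω|} ⊆
      {ω | t ^ (2 * q) * s.card ^ q ≤ (∑ i ∈ s, X i ω) ^ (2 * q)} := fun ω hω => by
    rw [mem_ofPred_eq, ← (even_two_mul q).pow_abs (∑ i ∈ s, X i ω)]
    calc t ^ (2 * q) * (s.card : ℝ) ^ q = (t * √s.card) ^ (2 * q) := by
          rw [mul_pow, pow_mul √_, Real.sq_sqrt hcard.le]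
      _ ≤ _ := pow_le_pow_left₀ (by positivity) (le_of_lt hω) _
  have hmarkov := (mul_meas_ge_le_integral_of_nonneg (μ := P)
    (ae_of_all _ fun ω => (even_two_mul q).pow_nonneg (∑ i ∈ s, X i ω))
    (h.integrable_sum_pow s (2 * q)) (t ^ (2 * q) * s.card ^ q)).trans
      ((le_abs_self _).trans (h.abs_integral_sum_pow_le (2 * q) s))
  rw [Nat.mul_div_cancel_left q two_pos, mul_right_comm] at hmarkov
  rw [le_div_iff₀' (by positivity)]
  exact (mul_le_mul_of_nonneg_left (measureReal_mono hsub) (by positivity)).trans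
    (le_of_mul_le_mul_right hmarkov (by positivity))

theorem measureReal_exists_lt_abs_sum_le (h : IsCenteredFamily P A X)
    (q : ℕ) (S : Finset (Finset ι)) {t : ℝ} (ht : 0 < t) :
    P.real {ω | ∃ s ∈ S, t * √s.card < |∑ i ∈ s, X i ω|} ≤
      S.card * (momentBound A (2 * q) / t ^ (2 * q)) := by
  calc P.real {ω | ∃ s ∈ S, t * √s.card < |∑ i ∈ s, X i ω|} ≤
      P.real (⋃ s ∈ S, {ω | t * √s.card < |∑ i ∈ s, X i ω|}) :=
        measureReal_mono (fun ω ⟨s, hs, h⟩ => mem_biUnion hs h) (measure_ne_top _ _)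
    _ ≤ ∑ s ∈ S, P.real {ω | t * √s.card < |∑ i ∈ s, X i ω|} :=
        measureReal_biUnion_finset_le _ _
    _ ≤ S.card * (momentBound A (2 * q) / t ^ (2 * q)) := by
        simpa only [nsmul_eq_mul] using
          S.sum_le_card_nsmul _ _ fun s _ => h.measureReal_lt_abs_sum_le q s ht

end IsCenteredFamily

/-- Markov's inequality for a moment of order `2 q` with `2 q b ≥ d + 2` makes the Borel–Cantelli
series summable. -/
theorem ae_eventually_abs_sum_le [IsProbabilityMeasure P] {ι : ℕ → Type*}
    {X : (n : ℕ) → ι n → Ω → ℝ} (S : (n : ℕ) → Finset (Finset (ι n))) {d : ℕ} {b : ℝ} (hb : 0 < b)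
    (hX : ∀ᶠ n in atTop, IsCenteredFamily P A (X n))
    (hS : ∀ᶠ n in atTop, (S n).card ≤ n ^ d) :
    ∀ᵐ ω ∂P, ∀ᶠ n : ℕ in atTop, ∀ s ∈ S n, |∑ i ∈ s, X n i ω| ≤ n ^ b * √s.card := by
  obtain ⟨q, hq⟩ := exists_nat_ge ((d + 2) / (2 * b))
  rw [div_le_iff₀ (by positivity)] at hq
  obtain ⟨N, hN⟩ := eventually_atTop.1 (hX.and (hS.and (eventually_ge_atTop 1)))
  let B (n : ℕ) : Set Ω := {ω | N ≤ n ∧ ∃ s ∈ S n, n ^ b * √s.card < |∑ i ∈ s, X n i ω|}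
  have hB (n : ℕ) : P (B n) ≤ ENNReal.ofReal (momentBound A (2 * q) * (1 / (n : ℝ) ^ 2)) := by
    rcases lt_or_ge n N with hn | hn
    · simp [B, hn.not_ge]
    obtain ⟨hXn, hSn, h1⟩ := hN n hn
    have hn1 : (1 : ℝ) ≤ n := by exact_mod_cast h1
    have hpow : (n : ℝ) ^ d * n ^ 2 ≤ ((n : ℝ) ^ b) ^ (2 * q) := by
      rw [← pow_add, ← Real.rpow_natCast, ← Real.rpow_natCast, ← Real.rpow_mul (by positivity)]
      refine Real.rpow_le_rpow_of_exponent_le hn1 ?_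
      push_cast
      linarith
    have hM := momentBound_nonneg A (2 * q)
    rw [← ofReal_measureReal]
    refine ENNReal.ofReal_le_ofReal ?_
    calc P.real (B n) ≤ P.real {ω | ∃ s ∈ S n, n ^ b * √s.card < |∑ i ∈ s, X n i ω|} :=
          measureReal_mono fun ω hω => hω.2
      _ ≤ (S n).card * (momentBound A (2 * q) / ((n : ℝ) ^ b) ^ (2 * q)) :=
          hXn.measureReal_exists_lt_abs_sum_le q (S n) (by positivity)
      _ ≤ (n : ℝ) ^ d * (momentBound A (2 * q) / ((n : ℝ) ^ d * n ^ 2)) := by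
          gcongr
          exact_mod_cast hSn
      _ = momentBound A (2 * q) * (1 / (n : ℝ) ^ 2) := by field_simp
  have hsum : ∑' n, P (B n) ≠ ⊤ :=
    ne_top_of_le_ne_top (Summable.tsum_ofReal_ne_top
      ((Real.summable_one_div_nat_pow.2 one_lt_two).mul_left _)) (ENNReal.tsum_le_tsum hB)
  filter_upwards [ae_eventually_notMem hsum] with ω hω
  filter_upwards [hω, eventually_ge_atTop N] with n hnB hn s hs
  by_contra! hlt
  exact hnB ⟨hn, s, hs, hlt⟩

end Moments

/-! ## Isotonic regression -/

section Isotonic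

theorem isIsotonicFit_isotonicFit {m : ℕ} (y : Fin m → ℝ) : IsIsotonicFit y (isotonicFit y) :=
  (exists_isIsotonicFit y).choose_spec

variable {m : ℕ} {y v : Fin m → ℝ}

/-- The fit `v` is the projection of `y` onto the convex cone of monotone vectors. -/
theorem IsIsotonicFit.sum_mul_sub_nonpos (h : IsIsotonicFit y v) {u : Fin m → ℝ}
    (hu : Monotone u) : ∑ i, (y i - v i) * (u i - v i) ≤ 0 := by
  have hsegment {t : ℝ} (ht : t ∈ Ioo (0 : ℝ) 1) :
      2 * ∑ i, (y i - v i) * (u i - v i) ≤ t * ∑ i, (u i - v i) ^ 2 := by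
    have hle := h.2 (fun i => (1 - t) * v i + t * u i) fun i j hij =>
      add_le_add (mul_le_mul_of_nonneg_left (h.1 hij) (by linarith [ht.2]))
        (mul_le_mul_of_nonneg_left (hu hij) ht.1.le)
    have hexp : ∑ i, (y i - ((1 - t) * v i + t * u i)) ^ 2 = ∑ i, (y i - v i) ^ 2 +
        t * (t * ∑ i, (u i - v i) ^ 2 - 2 * ∑ i, (y i - v i) * (u i - v i)) := by
      simp only [mul_sub, Finset.mul_sum, ← Finset.sum_sub_distrib, ← Finset.sum_add_distrib]
      exact Finset.sum_congr rfl fun i _ => by ring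
    rw [hexp, le_add_iff_nonneg_right, mul_nonneg_iff_of_pos_left ht.1] at hle
    linarith
  have hlim : Tendsto (fun t : ℝ => t * ∑ i, (u i - v i) ^ 2) (𝓝[>] 0) (𝓝 0) :=
    tendsto_nhdsWithin_of_tendsto_nhds <| Continuous.tendsto' (by fun_prop) _ _ (zero_mul _)
  have := ge_of_tendsto hlim (eventually_of_mem (Ioo_mem_nhdsGT one_pos) fun t ht => hsegment ht)
  linarith

theorem IsIsotonicFit.mul_sum_sub_nonpos (h : IsIsotonicFit y v) {B : Finset (Fin m)} {t : ℝ}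
    (hmono : Monotone fun i => v i + if i ∈ B then t else 0) :
    t * ∑ i ∈ B, (y i - v i) ≤ 0 := by
  simpa [mul_comm t, Finset.sum_mul, -Finset.sum_sub_distrib] using h.sum_mul_sub_nonpos hmono

theorem exists_pos_forall_add_le {ι : Type*} [Finite ι] (v : ι → ℝ) (θ : ℝ) :
    ∃ t > 0, ∀ i, v i < θ → v i + t ≤ θ := by
  have hgap : ∀ᶠ t in 𝓝[>] (0 : ℝ), ∀ i, v i < θ → v i + t ≤ θ := by
    refine eventually_all.2 fun i => ?_
    rcases lt_or_ge (v i) θ with hi | hi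
    · filter_upwards [Ioo_mem_nhdsGT (sub_pos.2 hi)] with t ht _
      linarith [ht.2]
    · exact Eventually.of_forall fun t hlt => absurd hlt hi.not_gt
  exact ((eventually_mem_nhdsWithin (s := Ioi 0)).and hgap).exists

theorem IsIsotonicFit.sum_le_of_isUpperSet (h : IsIsotonicFit y v) {θ : ℝ} {B : Finset (Fin m)}
    {D : Set (Fin m)} (hD : IsUpperSet D) (hB : ∀ i, i ∈ B ↔ i ∈ D ∧ v i < θ) :
    ∑ i ∈ B, y i ≤ B.card * θ := by
  obtain ⟨t, ht, hgap⟩ := exists_pos_forall_add_le v θ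
  have hsum : t * ∑ i ∈ B, (y i - v i) ≤ 0 := by
    refine h.mul_sum_sub_nonpos fun i j hij => ?_
    have hv := h.1 hij
    dsimp only
    split_ifs with hi hj hj
    · linarith
    · obtain ⟨hiD, hiθ⟩ := (hB i).1 hi
      have hj' : θ ≤ v j := not_lt.1 fun hlt => hj ((hB j).2 ⟨hD hij hiD, hlt⟩)
      linarith [hgap i hiθ]
    · linarith
    · linarith
  have hsum' := nonpos_of_mul_nonpos_right hsum ht
  have hθ := Finset.sum_le_card_nsmul B v θ fun i hi => ((hB i).1 hi).2.le
  rw [Finset.sum_sub_distrib] at hsum'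
  rw [nsmul_eq_mul] at hθ
  linarith

theorem IsIsotonicFit.le_sum_of_isLowerSet (h : IsIsotonicFit y v) {θ : ℝ} {B : Finset (Fin m)}
    {D : Set (Fin m)} (hD : IsLowerSet D) (hB : ∀ i, i ∈ B ↔ i ∈ D ∧ θ ≤ v i) :
    B.card * θ ≤ ∑ i ∈ B, y i := by
  obtain ⟨t, ht, hgap⟩ := exists_pos_forall_add_le v θ
  have hsum : -t * ∑ i ∈ B, (y i - v i) ≤ 0 := by
    refine h.mul_sum_sub_nonpos fun i j hij => ?_
    have hv := h.1 hij
    dsimp only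
    split_ifs with hi hj hj
    · linarith
    · linarith
    · obtain ⟨hjD, hjθ⟩ := (hB j).1 hj
      have hi' : v i < θ := not_le.1 fun hle => hi ((hB i).2 ⟨hD hij hjD, hle⟩)
      linarith [hgap i hi']
    · linarith
  have hsum' : 0 ≤ ∑ i ∈ B, (y i - v i) := by
    rw [neg_mul, neg_nonpos] at hsum
    exact nonneg_of_mul_nonneg_right hsum ht
  have hθ := Finset.card_nsmul_le_sum B v θ fun i hi => ((hB i).1 hi).2
  rw [Finset.sum_sub_distrib] at hsum'
  rw [nsmul_eq_mul] at hθ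
  linarith

theorem isotonicFit_le_isotonicRegression (x y : Fin m → ℝ) (i : Fin m) :
    isotonicFit y i ≤ isotonicRegression x y (x i) := by
  rw [isotonicRegression, if_pos ⟨i, le_rfl⟩]
  exact le_ciSup (f := fun j : {j // x j ≤ x i} => isotonicFit y j) (Set.finite_range _).bddAbove
    ⟨i, le_rfl⟩

theorem isotonicRegression_le_isotonicFit {x : Fin m → ℝ} (hx : Monotone x) (y : Fin m → ℝ)
    {t : ℝ} {i : Fin m} (hi : t < x i) : isotonicRegression x y t ≤ isotonicFit y i := by
  rw [isotonicRegression]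
  split_ifs with hex
  · have : Nonempty {j // x j ≤ t} := nonempty_subtype.2 hex
    exact ciSup_le fun k =>
      (isIsotonicFit_isotonicFit y).1 (hx.reflect_lt (k.2.trans_lt hi)).le
  · exact ciInf_le (Set.finite_range _).bddBelow i

theorem levelInverse_le {g : ℝ → ℝ} {θ t : ℝ} (ht : t ∈ Icc (0 : ℝ) 1) (h : θ ≤ g t) :
    levelInverse g θ ≤ t := by
  refine csInf_le ⟨0, ?_⟩ (mem_insert_of_mem _ ⟨ht, h⟩)
  rintro t (rfl | ht)
  · exact zero_le_one
  · exact ht.1.1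

theorem exists_of_levelInverse_lt {g : ℝ → ℝ} {θ s : ℝ} (hs : s ≤ 1) (h : levelInverse g θ < s) :
    ∃ t < s, θ ≤ g t := by
  obtain ⟨t, rfl | ht, hts⟩ := exists_lt_of_csInf_lt (insert_nonempty _ _) h
  · exact absurd hts hs.not_gt
  · exact ⟨t, hts, ht.2⟩

end Isotonic

/-! ## Localization of the first-stage estimator -/

/-- On `[0,1]`, the function `f` moves away from `f d₀` at least as fast as the line of slope `a`.
This makes errors of the first-stage estimator visible in the data. Multiplying by `t - d₀` treats
both sides of `d₀` at once. -/
def HasSlopeAtLeast (f : ℝ → ℝ) (d₀ a : ℝ) : Prop :=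
  ∀ t ∈ Icc (0 : ℝ) 1, a * (t - d₀) ^ 2 ≤ (f t - f d₀) * (t - d₀)

section Crossing

variable {f : ℝ → ℝ} {d₀ a h : ℝ}

theorem HasSlopeAtLeast.add_le (hf : HasSlopeAtLeast f d₀ a) (ha : 0 ≤ a) (hh : 0 < h) {t : ℝ}
    (ht : t ∈ Icc (0 : ℝ) 1) (hdt : d₀ + h ≤ t) : f d₀ + a * h ≤ f t := by
  have hpos : 0 < t - d₀ := by linarith
  have hle : a * (t - d₀) ≤ f t - f d₀ :=
    le_of_mul_le_mul_right (by linarith [hf t ht]) hpos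
  nlinarith

theorem HasSlopeAtLeast.le_sub (hf : HasSlopeAtLeast f d₀ a) (ha : 0 ≤ a) (hh : 0 < h) {t : ℝ}
    (ht : t ∈ Icc (0 : ℝ) 1) (htd : t ≤ d₀ - h) : f t ≤ f d₀ - a * h := by
  have hpos : 0 < d₀ - t := by linarith
  have hle : a * (d₀ - t) ≤ f d₀ - f t :=
    le_of_mul_le_mul_right (by linarith [hf t ht]) hpos
  nlinarith

variable {m : ℕ} {x e : Fin m → ℝ}

theorem exists_ordConnected_of_lt_levelInverse (hf : HasSlopeAtLeast f d₀ a) (ha : 0 ≤ a)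
    (hx : Monotone x) (hx01 : ∀ i, x i ∈ Icc (0 : ℝ) 1) (hh : 0 < h)
    (hlt : d₀ + 2 * h < levelInverse (isotonicRegression x fun i => f (x i) + e i) (f d₀)) :
    ∃ B : Finset (Fin m), (B : Set (Fin m)).OrdConnected ∧
      (∀ i, d₀ + h < x i → x i ≤ d₀ + 2 * h → i ∈ B) ∧ B.card * (a * h) ≤ |∑ i ∈ B, e i| := by
  set y : Fin m → ℝ := fun i => f (x i) + e i
  have hv := (isIsotonicFit_isotonicFit y).1
  let B : Finset (Fin m) := {i | d₀ + h < x i ∧ isotonicFit y i < f d₀}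
  have hB (i : Fin m) : i ∈ B ↔ i ∈ {i | d₀ + h < x i} ∧ isotonicFit y i < f d₀ := by simp [B]
  refine ⟨B, ⟨fun i hi j hj k hk => ?_⟩, fun i hi hi' => (hB i).2 ⟨hi, ?_⟩, ?_⟩
  · exact (hB k).2 ⟨((hB i).1 hi).1.trans_le (hx hk.1), (hv hk.2).trans_lt ((hB j).1 hj).2⟩
  · by_contra! hle
    exact hlt.not_ge ((levelInverse_le (hx01 i)
      (hle.trans (isotonicFit_le_isotonicRegression x y i))).trans hi')
  · have havg := (isIsotonicFit_isotonicFit y).sum_le_of_isUpperSet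
      (fun i j hij (hi : d₀ + h < x i) => hi.trans_le (hx hij)) hB
    have hlow := B.card_nsmul_le_sum (fun i => f (x i)) (f d₀ + a * h) fun i hi =>
      hf.add_le ha hh (hx01 i) ((hB i).1 hi).1.le
    rw [Finset.sum_add_distrib] at havg
    rw [nsmul_eq_mul] at hlow
    linarith [neg_le_abs (∑ i ∈ B, e i)]

theorem exists_ordConnected_of_levelInverse_lt (hf : HasSlopeAtLeast f d₀ a) (ha : 0 ≤ a)
    (hd₀ : d₀ ≤ 1) (hx : Monotone x) (hx01 : ∀ i, x i ∈ Icc (0 : ℝ) 1) (hh : 0 < h)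
    (hlt : levelInverse (isotonicRegression x fun i => f (x i) + e i) (f d₀) < d₀ - 2 * h) :
    ∃ B : Finset (Fin m), (B : Set (Fin m)).OrdConnected ∧
      (∀ i, d₀ - 2 * h < x i → x i ≤ d₀ - h → i ∈ B) ∧ B.card * (a * h) ≤ |∑ i ∈ B, e i| := by
  set y : Fin m → ℝ := fun i => f (x i) + e i
  have hv := (isIsotonicFit_isotonicFit y).1
  obtain ⟨t, ht, hθ⟩ := exists_of_levelInverse_lt (by linarith) hlt
  let B : Finset (Fin m) := {i | x i ≤ d₀ - h ∧ f d₀ ≤ isotonicFit y i}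
  have hB (i : Fin m) : i ∈ B ↔ i ∈ {i | x i ≤ d₀ - h} ∧ f d₀ ≤ isotonicFit y i := by simp [B]
  refine ⟨B, ⟨fun i hi j hj k hk => ?_⟩, fun i hi hi' => (hB i).2 ⟨hi', ?_⟩, ?_⟩
  · exact (hB k).2 ⟨(hx hk.2).trans ((hB j).1 hj).1, ((hB i).1 hi).2.trans (hv hk.1)⟩
  · exact hθ.trans (isotonicRegression_le_isotonicFit hx y (ht.trans hi))
  · have havg := (isIsotonicFit_isotonicFit y).le_sum_of_isLowerSet
      (fun i j hij (hi : x i ≤ d₀ - h) => (hx hij).trans hi) hB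
    have hup := B.sum_le_card_nsmul (fun i => f (x i)) (f d₀ - a * h) fun i hi =>
      hf.le_sub ha hh (hx01 i) ((hB i).1 hi).1
    rw [Finset.sum_add_distrib] at havg
    rw [nsmul_eq_mul] at hup
    linarith [le_abs_self (∑ i ∈ B, e i)]

theorem exists_ordConnected_of_lt_abs_levelInverse_sub (hf : HasSlopeAtLeast f d₀ a) (ha : 0 ≤ a)
    (hx : Monotone x) (hx01 : ∀ i, x i ∈ Icc (0 : ℝ) 1) (hh : 0 < h) (hd₀h : 2 * h ≤ d₀)
    (hd₀h' : d₀ + 2 * h ≤ 1)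
    (hlt : 2 * h < |levelInverse (isotonicRegression x fun i => f (x i) + e i) (f d₀) - d₀|) :
    ∃ B : Finset (Fin m), (B : Set (Fin m)).OrdConnected ∧
      (∃ s, 0 ≤ s ∧ s + h ≤ 1 ∧ ∀ i, s < x i → x i ≤ s + h → i ∈ B) ∧
      B.card * (a * h) ≤ |∑ i ∈ B, e i| := by
  rcases lt_abs.1 hlt with hlt | hlt
  · obtain ⟨B, hord, hmem, hsum⟩ :=
      exists_ordConnected_of_lt_levelInverse hf ha hx hx01 hh (by linarith)
    exact ⟨B, hord, ⟨d₀ + h, by linarith, by linarith,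
      fun i hi hi' => hmem i hi (by linarith)⟩, hsum⟩
  · obtain ⟨B, hord, hmem, hsum⟩ :=
      exists_ordConnected_of_levelInverse_lt hf ha (by linarith) hx hx01 hh (by linarith)
    exact ⟨B, hord, ⟨d₀ - 2 * h, by linarith, by linarith,
      fun i hi hi' => hmem i hi (by linarith)⟩, hsum⟩

end Crossing

/-! ## The design -/

/-- The number of design points of row `m` in an interval is at least a fixed multiple of `m` times
its length, up to an error `O(√m)`. This keeps intervals much longer than `m ^ (-1 / 2)` filled. -/
def HasLowerDensity (x : (m : ℕ) → Fin m → ℝ) : Prop :=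
  ∃ g₀ C : ℝ, 0 < g₀ ∧ ∀ (m : ℕ) (s t : ℝ), 0 ≤ s → s ≤ t → t ≤ 1 →
    g₀ * (t - s) * m - C * √m ≤ ({i | s < x m i ∧ x m i ≤ t} : Finset (Fin m)).card

theorem card_filter_Ioc_eq_mul_sub_empiricalCDF {m : ℕ} (hm : m ≠ 0) (x : Fin m → ℝ) {s t : ℝ}
    (hst : s ≤ t) :
    (({i | s < x i ∧ x i ≤ t} : Finset (Fin m)).card : ℝ) =
      m * (empiricalCDF x t - empiricalCDF x s) := by
  have hm' : (m : ℝ) ≠ 0 := Nat.cast_ne_zero.2 hm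
  have hsub : ({i | x i ≤ s} : Finset (Fin m)) ⊆ ({i | x i ≤ t} : Finset (Fin m)) :=
    Finset.monotone_filter_right _ fun i _ (hi : x i ≤ s) => hi.trans hst
  have hdiff : ({i | s < x i ∧ x i ≤ t} : Finset (Fin m)) =
      ({i | x i ≤ t} : Finset (Fin m)) \ ({i | x i ≤ s} : Finset (Fin m)) := by
    ext i
    simp [and_comm]
  rw [hdiff, Finset.cast_card_sdiff hsub, empiricalCDF, empiricalCDF, ← sub_div,
    mul_div_cancel₀ _ hm']

theorem mul_sub_le_cdf_sub_cdf {g : ℝ → ℝ} {c s t : ℝ}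
    [IsProbabilityMeasure (volume.withDensity fun u => ENNReal.ofReal (g u))]
    (hg : Measurable g) (hc : 0 ≤ c) (hst : s ≤ t) (hle : ∀ u ∈ Ioc s t, c ≤ g u) :
    c * (t - s) ≤ cdf (volume.withDensity fun u => ENNReal.ofReal (g u)) t -
      cdf (volume.withDensity fun u => ENNReal.ofReal (g u)) s := by
  rw [cdf_eq_real, cdf_eq_real, ← measureReal_sdiff (Iic_subset_Iic.2 hst) measurableSet_Iic,
    Iic_sdiff_Iic, measureReal_def, ← ENNReal.ofReal_le_iff_le_toReal (measure_ne_top _ _),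
    withDensity_apply _ measurableSet_Ioc]
  calc ENNReal.ofReal (c * (t - s)) = ∫⁻ _ in Ioc s t, ENNReal.ofReal c := by
        rw [setLIntegral_const, Real.volume_Ioc, ENNReal.ofReal_mul hc]
    _ ≤ ∫⁻ u in Ioc s t, ENNReal.ofReal (g u) :=
        setLIntegral_mono (by fun_prop) fun u hu => ENNReal.ofReal_le_ofReal (hle u hu)

theorem IsRegularDesign.hasLowerDensity {x : (m : ℕ) → Fin m → ℝ} (hx : IsRegularDesign x) :
    HasLowerDensity x := by
  obtain ⟨ν, g, hν, hgm, hg0, rfl, hgpos, hgd, -, C, hC⟩ := hx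
  obtain ⟨u, hu, hmin⟩ := isCompact_Icc.exists_isMinOn (nonempty_Icc.2 zero_le_one)
    hgd.continuousOn
  refine ⟨g u, 2 * C, hgpos u hu, fun m s t hs hst ht => ?_⟩
  rcases Nat.eq_zero_or_pos m with rfl | hm
  · simp
  have hm0 : (0 : ℝ) < m := by exact_mod_cast hm
  have hcdf := mul_sub_le_cdf_sub_cdf hgm (hg0 u) hst fun v hv =>
    hmin ⟨hs.trans hv.1.le, hv.2.trans ht⟩
  have hupper := (abs_le.1 (hC m hm t ⟨hs.trans hst, ht⟩)).1
  have hlower := (abs_le.1 (hC m hm s ⟨hs, hst.trans ht⟩)).2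
  rw [card_filter_Ioc_eq_mul_sub_empiricalCDF hm.ne' _ hst]
  calc g u * (t - s) * m - 2 * C * √m = m * (g u * (t - s) - 2 * (C / √m)) := by
        have := Real.sq_sqrt hm0.le
        field_simp
        linear_combination (-2 * C) * this
    _ ≤ _ := mul_le_mul_of_nonneg_left (by linarith) hm0.le

theorem HasLowerDensity.eventually_le_card {x : (m : ℕ) → Fin m → ℝ} (hx : HasLowerDensity x)
    {m : ℕ → ℕ} {c γ η : ℝ} (hc : 0 < c) (hm : ∀ᶠ n : ℕ in atTop, c * n ≤ m n) (hγ : γ < 1 / 2)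
    (hη : 0 < η) :
    ∃ κ > 0, ∀ᶠ n : ℕ in atTop, ∀ s : ℝ, 0 ≤ s → s + η * (n : ℝ) ^ (-γ) ≤ 1 →
      κ * (n : ℝ) ^ (1 - γ) ≤
        ({i | s < x (m n) i ∧ x (m n) i ≤ s + η * (n : ℝ) ^ (-γ)} : Finset (Fin (m n))).card := by
  obtain ⟨g₀, C, hg₀, hcard⟩ := hx
  have hlarge : Tendsto (fun n : ℕ => (n : ℝ) ^ (1 / 2 - γ)) atTop atTop :=
    (tendsto_rpow_atTop (by linarith)).comp tendsto_natCast_atTop_atTop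
  refine ⟨g₀ * η * c / 2, by positivity, ?_⟩
  filter_upwards [hm, hlarge.eventually_ge_atTop (2 * C / (g₀ * η * √c)), eventually_gt_atTop 0]
    with n hmn hn h0 s hs hs1
  have hn0 : (0 : ℝ) < n := by exact_mod_cast h0
  set h : ℝ := η * (n : ℝ) ^ (-γ) with hh
  have hh0 : 0 < h := by positivity
  have herror : C * √(m n) ≤ g₀ * h * m n / 2 := by
    have hsqrt : √c * √n ≤ √(m n) := by
      rw [← Real.sqrt_mul hc.le]
      exact Real.sqrt_le_sqrt hmn
    have hC : 2 * C ≤ g₀ * h * √(m n) := by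
      rw [div_le_iff₀ (by positivity), sub_eq_add_neg, Real.rpow_add hn0,
        ← Real.sqrt_eq_rpow] at hn
      calc 2 * C ≤ √n * (n : ℝ) ^ (-γ) * (g₀ * η * √c) := hn
        _ = g₀ * h * (√c * √n) := by ring
        _ ≤ _ := by gcongr
    have := mul_le_mul_of_nonneg_right hC (Real.sqrt_nonneg (m n))
    rw [mul_assoc (g₀ * h), Real.mul_self_sqrt (Nat.cast_nonneg _)] at this
    linarith
  have hmain := hcard (m n) s (s + h) hs (by linarith) hs1
  rw [add_sub_cancel_left] at hmain
  calc g₀ * η * c / 2 * (n : ℝ) ^ (1 - γ) = g₀ * h * (c * n) / 2 := by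
        rw [sub_eq_add_neg, Real.rpow_add hn0, Real.rpow_one]
        ring
    _ ≤ g₀ * h * m n / 2 := by gcongr
    _ ≤ _ := by linarith

/-! ## Sample sizes -/

section Sizes

variable {p : ℝ}

theorem mul_sub_one_le_firstSize (p : ℝ) (n : ℕ) : n * p - 1 ≤ firstSize p n := by
  have hfloor : ⌊(n : ℝ) * p⌋₊ ≤ firstSize p n := by
    unfold firstSize
    split_ifs <;> omega
  exact (Nat.sub_one_lt_floor _).le.trans (by exact_mod_cast hfloor)

theorem firstSize_le_mul_add_one (hp : 0 ≤ p) (n : ℕ) : firstSize p n ≤ n * p + 1 := by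
  have hfloor : firstSize p n ≤ ⌊(n : ℝ) * p⌋₊ + 1 := by
    unfold firstSize
    split_ifs <;> omega
  calc (firstSize p n : ℝ) ≤ ⌊(n : ℝ) * p⌋₊ + 1 := by exact_mod_cast hfloor
    _ ≤ n * p + 1 := by
      gcongr
      exact Nat.floor_le (by positivity)

theorem eventually_half_mul_le_firstSize (hp : 0 < p) :
    ∀ᶠ n : ℕ in atTop, p / 2 * n ≤ firstSize p n := by
  filter_upwards [tendsto_natCast_atTop_atTop.eventually_ge_atTop (2 / p)] with n hn
  rw [div_le_iff₀ hp] at hn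
  linarith [mul_sub_one_le_firstSize p n]

theorem eventually_firstSize_le (hp : p ∈ Ioo (0 : ℝ) 1) :
    ∀ᶠ n : ℕ in atTop, firstSize p n ≤ n := by
  filter_upwards [tendsto_natCast_atTop_atTop.eventually_ge_atTop (1 / (1 - p))] with n hn
  rw [div_le_iff₀ (by linarith [hp.2])] at hn
  exact_mod_cast (show (firstSize p n : ℝ) ≤ n by linarith [firstSize_le_mul_add_one hp.1.le n])

theorem secondSize_le (p : ℝ) (n : ℕ) : secondSize p n ≤ n := by
  unfold secondSize
  omega

theorem tendsto_firstSize_div (hp : p ∈ Ioo (0 : ℝ) 1) :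
    Tendsto (fun n : ℕ => (firstSize p n : ℝ) / n) atTop (𝓝 p) := by
  have hinv : Tendsto (fun n : ℕ => (n : ℝ)⁻¹) atTop (𝓝 0) := tendsto_inv_atTop_nhds_zero_nat
  refine tendsto_of_tendsto_of_tendsto_of_le_of_le'
    (by simpa using hinv.const_sub p) (by simpa using hinv.const_add p) ?_ ?_
  all_goals
    filter_upwards [eventually_gt_atTop 0] with n hn
    have hn0 : (0 : ℝ) < n := by exact_mod_cast hn
  · rw [le_div_iff₀ hn0, sub_mul, inv_mul_cancel₀ hn0.ne', mul_comm]
    exact mul_sub_one_le_firstSize p n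
  · rw [div_le_iff₀ hn0, add_mul, inv_mul_cancel₀ hn0.ne', mul_comm]
    exact firstSize_le_mul_add_one hp.1.le n

theorem tendsto_secondSize_div (hp : p ∈ Ioo (0 : ℝ) 1) :
    Tendsto (fun n : ℕ => (secondSize p n : ℝ) / n) atTop (𝓝 ((1 - p) / 2)) := by
  have hparity : Tendsto (fun n : ℕ => (((n - firstSize p n) % 2 : ℕ) : ℝ) / n) atTop (𝓝 0) :=
    squeeze_zero (fun n => by positivity)
      (fun n => div_le_div_of_nonneg_right
        (Nat.cast_le_one.2 (Nat.le_of_lt_succ (Nat.mod_lt _ two_pos))) (Nat.cast_nonneg n))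
      tendsto_one_div_atTop_nhds_zero_nat
  have hlim := (((tendsto_firstSize_div hp).const_sub 1).sub hparity).div_const 2
  rw [sub_zero] at hlim
  refine hlim.congr' ?_
  filter_upwards [eventually_firstSize_le hp, eventually_gt_atTop 0] with n hle hn
  have hn0 : (n : ℝ) ≠ 0 := by positivity
  have hsplit : firstSize p n + (n - firstSize p n) % 2 + 2 * secondSize p n = n := by
    have := Nat.mod_add_div (n - firstSize p n) 2
    unfold secondSize
    omega
  have hsplit' : (firstSize p n : ℝ) + ((n - firstSize p n) % 2 : ℕ) + 2 * secondSize p n = n := by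
    exact_mod_cast hsplit
  field_simp
  linarith

theorem eventually_mul_le_secondSize (hp : p ∈ Ioo (0 : ℝ) 1) :
    ∀ᶠ n : ℕ in atTop, (1 - p) / 4 * n ≤ secondSize p n := by
  filter_upwards [(tendsto_secondSize_div hp).eventually_const_le
    (show (1 - p) / 4 < (1 - p) / 2 by linarith [hp.2]), eventually_gt_atTop 0] with n hle hn
  rwa [le_div_iff₀ (by exact_mod_cast hn)] at hle

theorem tendsto_secondSize (hp : p ∈ Ioo (0 : ℝ) 1) :
    Tendsto (fun n => secondSize p n) atTop atTop := by
  refine tendsto_natCast_atTop_iff.1 (tendsto_atTop_mono' _ (eventually_mul_le_secondSize hp) ?_)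
  exact tendsto_natCast_atTop_atTop.const_mul_atTop (by linarith [hp.2])

end Sizes

/-! ## Almost sure behaviour of the errors -/

/-- For every `n`, the variables `e n i`, `i < n`, are independent with law `μ`: one of the three
arrays of an error array. -/
structure IsIIDArray {Ω : Type*} [MeasurableSpace Ω] (P : Measure Ω) (μ : Measure ℝ)
    (e : ℕ → ℕ → Ω → ℝ) : Prop where
  law : ∀ n, ∀ i < n, HasLaw (e n i) μ P
  indep : ∀ n, iIndepFun (fun i : Fin n => e n i) P

section AlmostSure

variable {Ω : Type*} [MeasurableSpace Ω] {P : Measure Ω} {μ : Measure ℝ} {e : ℕ → ℕ → Ω → ℝ}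

theorem IsErrorArray.isIIDArray {ε ε' ε'' : ℕ → ℕ → Ω → ℝ} (hε : IsErrorArray P μ ε ε' ε'') :
    IsIIDArray P μ ε ∧ IsIIDArray P μ ε' ∧ IsIIDArray P μ ε'' := by
  have hindep (j : Fin 3) (n : ℕ) :
      iIndepFun (fun i : Fin n => (![ε n, ε' n, ε'' n] j : ℕ → Ω → ℝ) i) P :=
    (hε.indep n).precomp (Prod.mk_right_injective j)
  exact ⟨⟨fun n i hi => (hε.law n i hi).1, hindep 0⟩,
    ⟨fun n i hi => (hε.law n i hi).2.1, hindep 1⟩, ⟨fun n i hi => (hε.law n i hi).2.2, hindep 2⟩⟩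

theorem IsIIDArray.isCenteredFamily (he : IsIIDArray P μ e) {n k : ℕ} (hk : k ≤ n) {φ : ℝ → ℝ}
    (hφ : Measurable φ) (hinteg : ∀ r : ℕ, Integrable (fun z => |φ z| ^ r) μ)
    (hmean : ∫ z, φ z ∂μ = 0) :
    IsCenteredFamily P (fun r => ∫ z, |φ z| ^ r ∂μ) (fun (i : Fin k) ω => φ (e n i ω)) := by
  have hlaw (i : Fin k) : HasLaw (e n i) μ P := he.law n i (i.2.trans_le hk)
  have hmap (i : Fin k) {ψ : ℝ → ℝ} (hψ : Measurable ψ) : ∫ ω, ψ (e n i ω) ∂P = ∫ z, ψ z ∂μ :=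
    (hlaw i).integral_comp hψ.aestronglyMeasurable
  exact
    { indep := ((he.indep n).precomp (Fin.castLE_injective hk)).comp (fun _ => φ) fun _ => hφ
      aemeasurable := fun i => hφ.comp_aemeasurable (hlaw i).aemeasurable
      integrable_pow := fun i r =>
        ((hlaw i).map_eq ▸ hinteg r).comp_aemeasurable (hlaw i).aemeasurable
      mean_eq := fun i => (hmap i hφ).trans hmean
      moment_le := fun i r => (hmap i (ψ := fun z => |φ z| ^ r) (by fun_prop)).le }

variable [IsProbabilityMeasure P] {k : ℕ → ℕ} {c : ℝ}

theorem IsIIDArray.ae_eventually_abs_sum_le (he : IsIIDArray P μ e) (hmom : HasAllMoments μ)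
    (hmean : ∫ z, z ∂μ = 0) (hk : ∀ᶠ n in atTop, k n ≤ n) {b : ℝ} (hb : 0 < b) :
    ∀ᵐ ω ∂P, ∀ᶠ n : ℕ in atTop, ∀ B : Finset (Fin (k n)), (B : Set (Fin (k n))).OrdConnected →
      |∑ i ∈ B, e n i ω| ≤ (n : ℝ) ^ b * √B.card := by
  let S (n : ℕ) : Finset (Finset (Fin (k n))) :=
    Finset.univ.image fun ij : Fin (k n) × Fin (k n) => Finset.Icc ij.1 ij.2
  have hcard : ∀ᶠ n in atTop, (S n).card ≤ n ^ 2 := by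
    filter_upwards [hk] with n hn
    calc (S n).card ≤ (Finset.univ : Finset (Fin (k n) × Fin (k n))).card := Finset.card_image_le
      _ = k n ^ 2 := by simp [sq]
      _ ≤ n ^ 2 := Nat.pow_le_pow_left hn 2
  filter_upwards [TwoStage.ae_eventually_abs_sum_le S hb
    (hk.mono fun n hn => he.isCenteredFamily hn measurable_id hmom hmean) hcard] with ω hω
  filter_upwards [hω] with n hn B hB
  rcases B.eq_empty_or_nonempty with rfl | hne
  · simp
  refine hn B (Finset.mem_image.2 ⟨(B.min' hne, B.max' hne), Finset.mem_univ _, ?_⟩)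
  ext i
  rw [Finset.mem_Icc]
  exact ⟨fun hi => hB.out (B.min'_mem hne) (B.max'_mem hne) hi,
    fun hi => ⟨B.min'_le i hi, B.le_max' i hi⟩⟩

theorem IsIIDArray.ae_tendsto_rpow_mul_mean (he : IsIIDArray P μ e) (hk : ∀ᶠ n in atTop, k n ≤ n)
    (hc : 0 < c) (hck : ∀ᶠ n : ℕ in atTop, c * n ≤ k n) {φ : ℝ → ℝ} (hφ : Measurable φ)
    (hinteg : ∀ r : ℕ, Integrable (fun z => |φ z| ^ r) μ) (hmean : ∫ z, φ z ∂μ = 0) {a : ℝ}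
    (ha : a < 1 / 2) :
    ∀ᵐ ω ∂P, Tendsto (fun n : ℕ => (n : ℝ) ^ a * mean fun i : Fin (k n) => φ (e n i ω))
      atTop (𝓝 0) := by
  obtain ⟨b, hb, hab⟩ : ∃ b > 0, a + b < 1 / 2 := ⟨(1 / 2 - a) / 2, by linarith, by linarith⟩
  have hlim : Tendsto (fun n : ℕ => (√c)⁻¹ * (n : ℝ) ^ (-(1 / 2 - (a + b)))) atTop (𝓝 0) := by
    simpa using (((tendsto_rpow_neg_atTop (sub_pos.2 hab)).comp
      tendsto_natCast_atTop_atTop).const_mul (√c)⁻¹)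
  filter_upwards [TwoStage.ae_eventually_abs_sum_le (fun n => {(Finset.univ : Finset (Fin (k n)))})
    (d := 0) hb (hk.mono fun n hn => he.isCenteredFamily hn hφ hinteg hmean)
    (Eventually.of_forall fun n => by simp)] with ω hω
  refine squeeze_zero_norm' ?_ hlim
  filter_upwards [hω, hck, eventually_gt_atTop 0] with n hsum hcn hn
  have hn0 : (0 : ℝ) < n := by exact_mod_cast hn
  have hk0 : (0 : ℝ) < k n := lt_of_lt_of_le (by positivity) hcn
  have hsqrt : √c * √n ≤ √(k n) := by
    rw [← Real.sqrt_mul hc.le]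
    exact Real.sqrt_le_sqrt hcn
  have hpow : (n : ℝ) ^ (-(1 / 2 - (a + b))) = (n : ℝ) ^ a * (n : ℝ) ^ b / √n := by
    rw [Real.sqrt_eq_rpow, ← Real.rpow_add hn0, ← Real.rpow_sub hn0]
    ring_nf
  have hsum' := hsum _ (Finset.mem_singleton_self _)
  rw [Finset.card_univ, Fintype.card_fin] at hsum'
  rw [Real.norm_eq_abs, abs_mul, abs_of_nonneg (by positivity), mean, abs_div, Nat.abs_cast, hpow]
  calc (n : ℝ) ^ a * (|∑ i : Fin (k n), φ (e n i ω)| / k n)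
      ≤ (n : ℝ) ^ a * ((n : ℝ) ^ b * √(k n) / k n) := by gcongr
    _ = (n : ℝ) ^ a * (n : ℝ) ^ b / √(k n) := by
        rw [mul_div_assoc, Real.sqrt_div_self', mul_one_div, mul_div_assoc]
    _ ≤ (n : ℝ) ^ a * (n : ℝ) ^ b / (√c * √n) := by gcongr
    _ = (√c)⁻¹ * ((n : ℝ) ^ a * (n : ℝ) ^ b / √n) := by
        rw [mul_comm √c, ← div_div, div_eq_inv_mul _ √c]

theorem IsIIDArray.ae_tendsto_mean [IsProbabilityMeasure μ] (he : IsIIDArray P μ e)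
    (hk : ∀ᶠ n in atTop, k n ≤ n) (hc : 0 < c) (hck : ∀ᶠ n : ℕ in atTop, c * n ≤ k n)
    {φ : ℝ → ℝ} (hφ : Measurable φ) (hinteg : ∀ r : ℕ, Integrable (fun z => |φ z| ^ r) μ) :
    ∀ᵐ ω ∂P, Tendsto (fun n : ℕ => mean fun i : Fin (k n) => φ (e n i ω)) atTop
      (𝓝 (∫ z, φ z ∂μ)) := by
  set l := ∫ z, φ z ∂μ
  have hφi : Integrable φ μ :=
    (integrable_norm_iff hφ.aestronglyMeasurable).1 (by simpa using hinteg 1)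
  have hinteg' (r : ℕ) : Integrable (fun z => |φ z - l| ^ r) μ := by
    refine (((hinteg r).add (integrable_const (|l| ^ r))).const_mul (2 ^ (r - 1))).mono'
      (by fun_prop) (ae_of_all _ fun z => ?_)
    rw [Real.norm_of_nonneg (by positivity)]
    exact (pow_le_pow_left₀ (abs_nonneg _) (abs_sub _ _) r).trans
      (add_pow_le (abs_nonneg _) (abs_nonneg _) r)
  have hzero : ∫ z, φ z - l ∂μ = 0 := by simp [integral_sub hφi (integrable_const _), l]
  filter_upwards [he.ae_tendsto_rpow_mul_mean hk hc hck (hφ.sub_const l) hinteg' hzero (a := 0)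
    (by norm_num)] with ω hω
  rw [← tendsto_sub_nhds_zero_iff]
  refine hω.congr' ?_
  filter_upwards [hck, eventually_gt_atTop 0] with n hcn hn
  have hk0 : (0 : ℝ) < k n := lt_of_lt_of_le (by positivity) hcn
  simp only [mean, Finset.sum_sub_distrib, Finset.sum_const, Finset.card_univ, Fintype.card_fin,
    nsmul_eq_mul, Real.rpow_zero, one_mul]
  field_simp

end AlmostSure

/-! ## Consistency of the first stage -/

section Consistency

variable {x : (m : ℕ) → Fin m → ℝ} {f : ℝ → ℝ} {d₀ a γ : ℝ}

theorem sqrt_mul_mul_rpow_le_one {t κ w N b : ℝ} (ht : 0 < t) (hκ : 0 < κ) (hw : 0 ≤ w)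
    (hN : κ * t ^ (1 - γ) ≤ N) (h : N * (w * t ^ (-γ)) ≤ t ^ b * √N) :
    √κ * w * t ^ ((1 - 3 * γ) / 2 - b) ≤ 1 := by
  have hN0 : 0 < N := lt_of_lt_of_le (by positivity) hN
  have hroot : √N * (w * t ^ (-γ)) ≤ t ^ b := by
    refine le_of_mul_le_mul_right ?_ (Real.sqrt_pos.2 hN0)
    rwa [mul_right_comm, Real.mul_self_sqrt hN0.le]
  have hroot' : √κ * t ^ ((1 - γ) / 2) ≤ √N := by
    rw [show (1 - γ) / 2 = (1 - γ) * (1 / 2) by ring, Real.rpow_mul ht.le, ← Real.sqrt_eq_rpow,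
      ← Real.sqrt_mul hκ.le]
    exact Real.sqrt_le_sqrt hN
  calc √κ * w * t ^ ((1 - 3 * γ) / 2 - b)
      = √κ * t ^ ((1 - γ) / 2) * (w * t ^ (-γ)) / t ^ b := by
        rw [show (1 - 3 * γ) / 2 - b = (1 - γ) / 2 + -γ - b by ring, Real.rpow_sub ht,
          Real.rpow_add ht]
        ring
    _ ≤ √N * (w * t ^ (-γ)) / t ^ b := by gcongr
    _ ≤ 1 := div_le_one_of_le₀ hroot (by positivity)

theorem eventually_abs_levelInverse_sub_le (hf : HasSlopeAtLeast f d₀ a) (ha : 0 < a)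
    (hd₀ : d₀ ∈ Ioo (0 : ℝ) 1) (hmono : ∀ m, Monotone (x m)) (hx01 : ∀ m i, x m i ∈ Icc (0 : ℝ) 1)
    (hx : HasLowerDensity x) {m : ℕ → ℕ} {c : ℝ} (hc : 0 < c)
    (hm : ∀ᶠ n : ℕ in atTop, c * n ≤ m n) (hγ : 0 < γ) {b : ℝ} (hb : 0 ≤ b)
    (hbγ : 2 * b < 1 - 3 * γ) {e : ℕ → ℕ → ℝ}
    (he : ∀ᶠ n : ℕ in atTop, ∀ B : Finset (Fin (m n)), (B : Set (Fin (m n))).OrdConnected →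
      |∑ i ∈ B, e n i| ≤ (n : ℝ) ^ b * √B.card) {η : ℝ} (hη : 0 < η) :
    ∀ᶠ n : ℕ in atTop, |levelInverse (isotonicRegression (x (m n)) fun i => f (x (m n) i) + e n i)
      (f d₀) - d₀| ≤ 2 * (η * (n : ℝ) ^ (-γ)) := by
  obtain ⟨κ, hκ, hcard⟩ := hx.eventually_le_card hc hm (by linarith : γ < 1 / 2) hη
  have hsmall : Tendsto (fun n : ℕ => 2 * (η * (n : ℝ) ^ (-γ))) atTop (𝓝 0) := by
    simpa using (((tendsto_rpow_neg_atTop hγ).comp tendsto_natCast_atTop_atTop).const_mul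
      η).const_mul 2
  have hlarge : Tendsto (fun n : ℕ => √κ * (a * η) * (n : ℝ) ^ ((1 - 3 * γ) / 2 - b)) atTop atTop :=
    ((tendsto_rpow_atTop (by linarith)).comp tendsto_natCast_atTop_atTop).const_mul_atTop
      (by positivity)
  filter_upwards [he, hcard, hsmall.eventually_le_const (lt_min hd₀.1 (sub_pos.2 hd₀.2)),
    hlarge.eventually_gt_atTop 1, eventually_gt_atTop 0] with n he hcard hsmall hlarge hn
  have hn0 : (0 : ℝ) < n := by exact_mod_cast hn
  have hh0 : 0 < η * (n : ℝ) ^ (-γ) := by positivity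
  by_contra! hlt
  obtain ⟨B, hB, ⟨s, hs, hs1, hsB⟩, hsum⟩ := exists_ordConnected_of_lt_abs_levelInverse_sub hf ha.le
    (hmono _) (hx01 _) hh0 (hsmall.trans (min_le_left _ _))
    (by linarith [hsmall.trans (min_le_right _ _)]) hlt
  have hBcard : κ * (n : ℝ) ^ (1 - γ) ≤ B.card :=
    (hcard s hs hs1).trans (Nat.cast_le.2 (Finset.card_le_card fun i hi => by
      obtain ⟨hsi, his⟩ := (Finset.mem_filter.1 hi).2
      exact hsB i hsi his))
  refine hlarge.not_ge (sqrt_mul_mul_rpow_le_one hn0 hκ (by positivity) hBcard ?_)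
  rw [mul_assoc a]
  exact hsum.trans (he B hB)

theorem tendsto_rpow_mul_of_forall_eventually_abs_le {u : ℕ → ℝ}
    (h : ∀ η > 0, ∀ᶠ n : ℕ in atTop, |u n| ≤ 2 * (η * (n : ℝ) ^ (-γ))) :
    Tendsto (fun n : ℕ => (n : ℝ) ^ γ * u n) atTop (𝓝 0) := by
  refine Metric.tendsto_nhds.2 fun δ hδ => ?_
  filter_upwards [h (δ / 4) (by positivity), eventually_gt_atTop 0] with n hu hn
  have hn0 : (0 : ℝ) < n := by exact_mod_cast hn
  rw [Real.dist_eq, sub_zero, abs_mul, abs_of_nonneg (by positivity)]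
  calc (n : ℝ) ^ γ * |u n| ≤ (n : ℝ) ^ γ * (2 * (δ / 4 * (n : ℝ) ^ (-γ))) := by gcongr
    _ = δ / 2 * ((n : ℝ) ^ γ * (n : ℝ) ^ (-γ)) := by ring
    _ = δ / 2 := by rw [← Real.rpow_add hn0, add_neg_cancel, Real.rpow_zero, mul_one]
    _ < δ := half_lt_self hδ

theorem IsIIDArray.ae_tendsto_firstEstimate {Ω : Type*} [MeasurableSpace Ω] {P : Measure Ω}
    [IsProbabilityMeasure P] {μ : Measure ℝ} {ε : ℕ → ℕ → Ω → ℝ} (hε : IsIIDArray P μ ε)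
    (hmom : HasAllMoments μ) (hmean : ∫ z, z ∂μ = 0) (hf : HasSlopeAtLeast f d₀ a) (ha : 0 < a)
    (hd₀ : d₀ ∈ Ioo (0 : ℝ) 1) (hmono : ∀ m, Monotone (x m)) (hx01 : ∀ m i, x m i ∈ Icc (0 : ℝ) 1)
    (hx : HasLowerDensity x) {p : ℝ} (hp : p ∈ Ioo (0 : ℝ) 1) (hγ : γ ∈ Ioo (0 : ℝ) (1 / 3)) :
    ∀ᵐ ω ∂P, Tendsto (fun n : ℕ =>
      (n : ℝ) ^ γ * (firstEstimate f d₀ p x n (fun i => ε n i ω) - d₀)) atTop (𝓝 0) := by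
  obtain ⟨b, hb, hbγ⟩ : ∃ b > 0, 2 * b < 1 - 3 * γ :=
    ⟨(1 - 3 * γ) / 4, by linarith [hγ.2], by linarith [hγ.2]⟩
  filter_upwards [hε.ae_eventually_abs_sum_le hmom hmean (eventually_firstSize_le hp) hb] with ω hω
  refine tendsto_rpow_mul_of_forall_eventually_abs_le fun η hη => ?_
  simp only [firstEstimate]
  exact eventually_abs_levelInverse_sub_le (e := fun n i => ε n i ω) hf ha hd₀ hmono hx01 hx
    (half_pos hp.1) (eventually_half_mul_le_firstSize hp.1) hγ.1 hb.le hbγ hω hη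

end Consistency

/-! ## Characteristic functions of sums -/

section CharacteristicFunctions

theorem tendsto_sub_div_of_hasDerivAt {ι 𝕜 : Type*} [NontriviallyNormedField 𝕜] {l : Filter ι}
    {f : 𝕜 → 𝕜} {b c d : 𝕜} (hf : HasDerivAt f b d) {u δ : ι → 𝕜} (hδ : Tendsto δ l (𝓝 0))
    (hδ0 : ∀ᶠ n in l, δ n ≠ 0) (hu : Tendsto (fun n => (u n - d) / δ n) l (𝓝 c)) :
    Tendsto (fun n => (f (u n) - f d) / δ n) l (𝓝 (b * c)) := by
  have hud : Tendsto u l (𝓝 d) := by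
    have h := (hu.mul hδ).add_const d
    rw [mul_zero, zero_add] at h
    refine h.congr' (hδ0.mono fun n hn => ?_)
    rw [div_mul_cancel₀ _ hn, sub_add_cancel]
  have hO : (fun n => u n - d) =O[l] δ :=
    Asymptotics.isBigO_of_div_tendsto_nhds (hδ0.mono fun n hn h => absurd h hn) c hu
  have ho := (hf.isLittleO.comp_tendsto hud).trans_isBigO hO
  have h := ho.tendsto_div_nhds_zero.add (hu.const_mul b)
  rw [zero_add] at h
  refine h.congr fun n => ?_
  simp only [Function.comp_apply, smul_eq_mul]
  ring

theorem tendsto_pow_exp_of_tendsto_mul_sub_one {k : ℕ → ℕ} (hk : Tendsto k atTop atTop)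
    {φ : ℕ → ℂ} {t : ℂ} (h : Tendsto (fun n => k n * (φ n - 1)) atTop (𝓝 t)) :
    Tendsto (fun n => φ n ^ k n) atTop (𝓝 (Complex.exp t)) := by
  have hinv : Tendsto (fun n => (k n : ℂ)⁻¹) atTop (𝓝 0) :=
    (tendsto_inv_atTop_nhds_zero_nat (𝕜 := ℂ)).comp hk
  have hk0 := hk.eventually_ne_atTop 0
  have hφ : Tendsto φ atTop (𝓝 1) := by
    have hsub := (h.mul hinv).add_const 1
    rw [mul_zero, zero_add] at hsub
    refine hsub.congr' (hk0.mono fun n hn => ?_)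
    have : (k n : ℂ) ≠ 0 := Nat.cast_ne_zero.2 hn
    field_simp
    ring
  have hlog := tendsto_sub_div_of_hasDerivAt (Complex.hasDerivAt_log Complex.one_mem_slitPlane)
    hinv (hk0.mono fun n hn => inv_ne_zero (Nat.cast_ne_zero.2 hn))
    (h.congr fun n => by rw [div_inv_eq_mul, mul_comm])
  rw [inv_one, one_mul] at hlog
  refine ((Complex.continuous_exp.tendsto t).comp hlog).congr' ?_
  filter_upwards [hφ.eventually_ne one_ne_zero] with n hn
  rw [Function.comp_apply, Complex.log_one, sub_zero, div_inv_eq_mul, mul_comm,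
    Complex.exp_nat_mul, Complex.exp_log hn]

theorem norm_exp_mul_I_sub_le (t : ℝ) :
    ‖Complex.exp (t * Complex.I) - (1 + t * Complex.I - ((t ^ 2 / 2 : ℝ) : ℂ))‖ ≤ 4 * |t| ^ 3 := by
  have hn : ‖(t : ℂ) * Complex.I‖ = |t| := by simp
  rcases le_or_gt |t| 1 with ht | ht
  · have hexp := Complex.norm_exp_sub_sum_le_norm_mul_exp (t * Complex.I) 3
    have hsum : ∑ m ∈ Finset.range 3, ((t : ℂ) * Complex.I) ^ m / (m.factorial : ℂ) =
        1 + t * Complex.I - ((t ^ 2 / 2 : ℝ) : ℂ) := by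
      simp only [Finset.sum_range_succ, Finset.sum_range_zero, mul_pow, Complex.I_sq]
      norm_num [Nat.factorial]
      ring
    rw [hsum, hn] at hexp
    have hle : Real.exp |t| ≤ 4 :=
      (Real.exp_le_exp.2 ht).trans (Real.exp_one_lt_d9.le.trans (by norm_num))
    calc _ ≤ |t| ^ 3 * Real.exp |t| := hexp
      _ ≤ |t| ^ 3 * 4 := by gcongr
      _ = 4 * |t| ^ 3 := mul_comm _ _
  · have h1 : |t| ≤ |t| ^ 3 := le_self_pow₀ ht.le (by norm_num)
    have h2 : |t| ^ 2 ≤ |t| ^ 3 := pow_le_pow_right₀ ht.le (by norm_num)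
    calc _ ≤ ‖Complex.exp (t * Complex.I)‖ + (‖(1 : ℂ)‖ + ‖(t : ℂ) * Complex.I‖ +
          ‖((t ^ 2 / 2 : ℝ) : ℂ)‖) :=
          (norm_sub_le _ _).trans (by gcongr; exact (norm_sub_le _ _).trans (by
            gcongr; exact norm_add_le _ _))
      _ = 1 + (1 + |t| + |t| ^ 2 / 2) := by
          rw [Complex.norm_exp_ofReal_mul_I, norm_one, hn, Complex.norm_real,
            Real.norm_of_nonneg (by positivity), sq_abs]
      _ ≤ 4 * |t| ^ 3 := by linarith

theorem norm_integral_exp_mul_I_sub_le {Ω : Type*} [MeasurableSpace Ω] {P : Measure Ω}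
    [IsProbabilityMeasure P] {X : Ω → ℝ} (hX : MemLp X 3 P) (hmean : ∫ ω, X ω ∂P = 0) :
    ‖∫ ω, Complex.exp (X ω * Complex.I) ∂P - ((1 - (∫ ω, X ω ^ 2 ∂P) / 2 : ℝ) : ℂ)‖ ≤
      4 * ∫ ω, |X ω| ^ 3 ∂P := by
  have hexp : Integrable (fun ω => Complex.exp (X ω * Complex.I)) P :=
    Integrable.of_bound (C := 1) (by have := hX.aestronglyMeasurable; fun_prop)
      (ae_of_all _ fun ω => (Complex.norm_exp_ofReal_mul_I _).le)
  have hX1 : Integrable (fun ω => (X ω : ℂ) * Complex.I) P :=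
    (hX.integrable (by norm_num)).ofReal.mul_const _
  have hlin : Integrable (fun ω => 1 + (X ω : ℂ) * Complex.I) P := (integrable_const 1).add hX1
  have hX2 : Integrable (fun ω => ((X ω ^ 2 / 2 : ℝ) : ℂ)) P :=
    ((hX.mono_exponent (by norm_num)).integrable_sq.div_const 2).ofReal
  have hX3 : Integrable (fun ω => |X ω| ^ 3) P := by
    simpa using hX.integrable_norm_pow (p := 3) (by norm_num)
  have htaylor : ((1 - (∫ ω, X ω ^ 2 ∂P) / 2 : ℝ) : ℂ) =
      ∫ ω, 1 + X ω * Complex.I - ((X ω ^ 2 / 2 : ℝ) : ℂ) ∂P := by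
    rw [integral_sub hlin hX2, integral_add (integrable_const _) hX1,
      integral_mul_const, integral_complex_ofReal, integral_complex_ofReal, integral_div, hmean]
    simp
  have hquad : Integrable (fun ω => 1 + X ω * Complex.I - ((X ω ^ 2 / 2 : ℝ) : ℂ)) P := hlin.sub hX2
  rw [htaylor, ← integral_sub hexp hquad, ← integral_const_mul]
  exact norm_integral_le_of_norm_le (hX3.const_mul 4)
    (ae_of_all _ fun ω => norm_exp_mul_I_sub_le (X ω))

theorem tendsto_integral_exp_mul_I_pow {Ω : ℕ → Type*} [∀ n, MeasurableSpace (Ω n)]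
    {P : (n : ℕ) → Measure (Ω n)} {X : (n : ℕ) → Ω n → ℝ} {k : ℕ → ℕ} {v : ℝ}
    (hk : Tendsto k atTop atTop) (hP : ∀ᶠ n in atTop, IsProbabilityMeasure (P n))
    (hX : ∀ n, MemLp (X n) 3 (P n)) (hmean : ∀ n, ∫ ω, X n ω ∂(P n) = 0)
    (hsq : Tendsto (fun n => k n * ∫ ω, X n ω ^ 2 ∂(P n)) atTop (𝓝 v))
    (hcube : Tendsto (fun n => k n * ∫ ω, |X n ω| ^ 3 ∂(P n)) atTop (𝓝 0)) :
    Tendsto (fun n => (∫ ω, Complex.exp (X n ω * Complex.I) ∂(P n)) ^ k n) atTop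
      (𝓝 (Complex.exp ((-(v / 2) : ℝ) : ℂ))) := by
  refine tendsto_pow_exp_of_tendsto_mul_sub_one hk ?_
  have hmain : Tendsto (fun n => ((-(k n * (∫ ω, X n ω ^ 2 ∂(P n)) / 2) : ℝ) : ℂ)) atTop
      (𝓝 ((-(v / 2) : ℝ) : ℂ)) := (hsq.div_const 2).neg.ofReal
  have hrem : Tendsto (fun n => (k n : ℂ) * (∫ ω, Complex.exp (X n ω * Complex.I) ∂(P n) -
      ((1 - (∫ ω, X n ω ^ 2 ∂(P n)) / 2 : ℝ) : ℂ))) atTop (𝓝 0) := by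
    refine squeeze_zero_norm' ?_ (by simpa using hcube.const_mul 4)
    filter_upwards [hP] with n hn
    rw [norm_mul, Complex.norm_natCast, mul_left_comm]
    gcongr
    exact norm_integral_exp_mul_I_sub_le (hX n) (hmean n)
  refine ((hrem.add hmain).congr fun n => ?_).trans (by rw [zero_add])
  push_cast
  ring

end CharacteristicFunctions

/-! ## Convergence in distribution -/

section Distribution

theorem norm_exp_mul_I_sub_exp_mul_I_le (x y : ℝ) :
    ‖Complex.exp (x * Complex.I) - Complex.exp (y * Complex.I)‖ ≤ |x - y| := by
  have hfactor : Complex.exp (x * Complex.I) - Complex.exp (y * Complex.I) =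
      Complex.exp (y * Complex.I) * (Complex.exp (Complex.I * (x - y : ℝ)) - 1) := by
    rw [mul_sub, mul_one, ← Complex.exp_add]
    congr 2
    push_cast
    ring
  rw [hfactor, norm_mul, Complex.norm_exp_ofReal_mul_I, one_mul]
  exact Real.norm_exp_I_mul_ofReal_sub_one_le

theorem norm_integral_exp_mul_I_sub_integral_exp_mul_I_le {Ω : Type*} [MeasurableSpace Ω]
    {P : Measure Ω} [IsProbabilityMeasure P] {X Y : Ω → ℝ} (hX : AEMeasurable X P)
    (hY : AEMeasurable Y P) (s : ℝ) {η : ℝ} (hη : 0 ≤ η) :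
    ‖∫ ω, Complex.exp ((s * X ω : ℝ) * Complex.I) ∂P -
        ∫ ω, Complex.exp ((s * Y ω : ℝ) * Complex.I) ∂P‖ ≤
      |s| * η + 2 * P.real {ω | η < |X ω - Y ω|} := by
  have hinteg {Z : Ω → ℝ} (hZ : AEMeasurable Z P) :
      Integrable (fun ω => Complex.exp ((s * Z ω : ℝ) * Complex.I)) P :=
    Integrable.of_bound (C := 1) (by fun_prop)
      (ae_of_all _ fun ω => (Complex.norm_exp_ofReal_mul_I _).le)
  have hnull : NullMeasurableSet {ω | η < |X ω - Y ω|} P :=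
    nullMeasurableSet_lt aemeasurable_const (hX.sub hY).abs
  have hind : Integrable ({ω | η < |X ω - Y ω|}.indicator fun _ => (2 : ℝ)) P :=
    (integrable_const (2 : ℝ)).indicator₀ hnull
  rw [← integral_sub (hinteg hX) (hinteg hY)]
  calc _ ≤ ∫ ω, (|s| * η + {ω | η < |X ω - Y ω|}.indicator (fun _ => (2 : ℝ)) ω) ∂P := by
        refine norm_integral_le_of_norm_le ((integrable_const _).add hind) (ae_of_all _ fun ω => ?_)
        by_cases hω : ω ∈ {ω | η < |X ω - Y ω|}
        · rw [indicator_of_mem hω]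
          refine (norm_sub_le _ _).trans ?_
          rw [Complex.norm_exp_ofReal_mul_I, Complex.norm_exp_ofReal_mul_I]
          linarith [mul_nonneg (abs_nonneg s) hη]
        · rw [indicator_of_notMem hω, add_zero]
          refine (norm_exp_mul_I_sub_exp_mul_I_le _ _).trans ?_
          rw [← mul_sub, abs_mul]
          exact mul_le_mul_of_nonneg_left (not_lt.1 hω) (abs_nonneg _)
    _ = |s| * η + 2 * P.real {ω | η < |X ω - Y ω|} := by
        rw [integral_add (integrable_const _) hind, integral_indicator₀ hnull, integral_const,
          setIntegral_const]
        simp [mul_comm]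

theorem charFun_map_eq_integral_exp_mul_I {Ω : Type*} [MeasurableSpace Ω] {P : Measure Ω}
    {X : Ω → ℝ} (hX : AEMeasurable X P) (s : ℝ) :
    charFun (P.map X) s = ∫ ω, Complex.exp ((s * X ω : ℝ) * Complex.I) ∂P := by
  rw [charFun_apply_real, integral_map hX (by fun_prop)]
  push_cast
  rfl

variable {Ω : ℕ → Type*} {Ω' : Type*} [∀ n, MeasurableSpace (Ω n)] [MeasurableSpace Ω']
  {P : (n : ℕ) → Measure (Ω n)} [∀ n, IsProbabilityMeasure (P n)] {Q : Measure Ω'}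
  [IsProbabilityMeasure Q] {X Y : (n : ℕ) → Ω n → ℝ} {Z : Ω' → ℝ}

theorem tendstoInDistribution_iff_tendsto_integral_exp_mul_I (hX : ∀ n, AEMeasurable (X n) (P n))
    (hZ : AEMeasurable Z Q) :
    TendstoInDistribution X atTop Z P Q ↔ ∀ s : ℝ,
      Tendsto (fun n => ∫ ω, Complex.exp ((s * X n ω : ℝ) * Complex.I) ∂(P n)) atTop
        (𝓝 (∫ ω, Complex.exp ((s * Z ω : ℝ) * Complex.I) ∂Q)) := by
  refine ⟨fun h s => ?_, fun h => ⟨hX, hZ, ?_⟩⟩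
  · simpa only [ProbabilityMeasure.coe_mk, charFun_map_eq_integral_exp_mul_I (hX _),
      charFun_map_eq_integral_exp_mul_I hZ] using
      ProbabilityMeasure.tendsto_iff_tendsto_charFun.1 h.tendsto s
  · refine ProbabilityMeasure.tendsto_iff_tendsto_charFun.2 fun s => ?_
    simpa only [ProbabilityMeasure.coe_mk, charFun_map_eq_integral_exp_mul_I (hX _),
      charFun_map_eq_integral_exp_mul_I hZ] using h s

theorem tendstoInDistribution_of_tendstoInDistribution_of_sub
    (hY : TendstoInDistribution Y atTop Z P Q) (hX : ∀ n, AEMeasurable (X n) (P n))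
    (h : ∀ η > 0, ∀ᶠ n in atTop, (P n).real {ω | η < |X n ω - Y n ω|} ≤ η) :
    TendstoInDistribution X atTop Z P Q := by
  refine (tendstoInDistribution_iff_tendsto_integral_exp_mul_I hX hY.aemeasurable_limit).2
    fun s => ?_
  have hYs := (tendstoInDistribution_iff_tendsto_integral_exp_mul_I hY.forall_aemeasurable
    hY.aemeasurable_limit).1 hY s
  suffices hdiff : Tendsto (fun n => ∫ ω, Complex.exp ((s * X n ω : ℝ) * Complex.I) ∂(P n) -
      ∫ ω, Complex.exp ((s * Y n ω : ℝ) * Complex.I) ∂(P n)) atTop (𝓝 0) by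
    simpa using hdiff.add hYs
  refine Metric.tendsto_nhds.2 fun δ hδ => ?_
  obtain ⟨η, hη, hηδ⟩ : ∃ η > 0, (|s| + 2) * η < δ :=
    ⟨δ / (|s| + 3), by positivity, by
      rw [mul_div_assoc', div_lt_iff₀ (by positivity)]
      nlinarith⟩
  filter_upwards [h η hη] with n hn
  rw [dist_zero_right]
  calc _ ≤ |s| * η + 2 * (P n).real {ω | η < |X n ω - Y n ω|} :=
        norm_integral_exp_mul_I_sub_integral_exp_mul_I_le (hX n) (hY.forall_aemeasurable n) s hη.le
    _ ≤ |s| * η + 2 * η := by gcongr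
    _ = (|s| + 2) * η := (add_mul _ _ _).symm
    _ < δ := hηδ

end Distribution

section Polya

theorem tendstoLocallyUniformly_of_monotone_of_tendsto {F : ℝ → ℝ} {G : ℕ → ℝ → ℝ}
    (hF : Monotone F) (hFc : Continuous F) (hG : ∀ n, Monotone (G n))
    (h : ∀ t, Tendsto (fun n => G n t) atTop (𝓝 (F t))) :
    TendstoLocallyUniformly G F atTop := by
  refine Metric.tendstoLocallyUniformly_iff.2 fun δ hδ t => ?_
  obtain ⟨r, hr, hcont⟩ := Metric.continuous_iff.1 hFc t (δ / 4) (by positivity)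
  have hleft := hcont (t - r / 2) (by rw [Real.dist_eq, abs_lt]; constructor <;> linarith)
  have hright := hcont (t + r / 2) (by rw [Real.dist_eq, abs_lt]; constructor <;> linarith)
  rw [Real.dist_eq, abs_lt] at hleft hright
  refine ⟨Ioo (t - r / 2) (t + r / 2), Ioo_mem_nhds (by linarith) (by linarith), ?_⟩
  filter_upwards [Metric.tendsto_nhds.1 (h (t - r / 2)) (δ / 4) (by positivity),
    Metric.tendsto_nhds.1 (h (t + r / 2)) (δ / 4) (by positivity)] with n hGl hGr s hs
  rw [Real.dist_eq, abs_lt] at hGl hGr ⊢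
  have hG1 := hG n hs.1.le
  have hG2 := hG n hs.2.le
  have hF1 := hF hs.1.le
  have hF2 := hF hs.2.le
  constructor <;> linarith

theorem eventually_forall_abs_sub_le_of_monotone {F : ℝ → ℝ} {G : ℕ → ℝ → ℝ} (hF : Monotone F)
    (hFc : Continuous F) (hF0 : Tendsto F atBot (𝓝 0)) (hF1 : Tendsto F atTop (𝓝 1))
    (hG : ∀ n, Monotone (G n)) (hG01 : ∀ n t, G n t ∈ Icc (0 : ℝ) 1)
    (h : ∀ t, Tendsto (fun n => G n t) atTop (𝓝 (F t))) {η : ℝ} (hη : 0 < η) :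
    ∀ᶠ n in atTop, ∀ t, |G n t - F t| ≤ η := by
  obtain ⟨a, ha⟩ := (hF0.eventually_lt_const (half_pos hη)).exists
  obtain ⟨b, hb⟩ := (hF1.eventually_const_lt (show 1 - η / 2 < 1 by linarith)).exists
  have hunif : TendstoUniformlyOn G F atTop (Icc a b) :=
    (tendstoLocallyUniformlyOn_iff_tendstoUniformlyOn_of_compact isCompact_Icc).1
      (tendstoLocallyUniformly_of_monotone_of_tendsto hF hFc hG h).tendstoLocallyUniformlyOn
  filter_upwards [Metric.tendstoUniformlyOn_iff.1 hunif η hη,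
    Metric.tendsto_nhds.1 (h a) (η / 2) (half_pos hη),
    Metric.tendsto_nhds.1 (h b) (η / 2) (half_pos hη)] with n hab hna hnb t
  rw [Real.dist_eq, abs_lt] at hna hnb
  have hF0t := hF.le_of_tendsto hF0 t
  have hF1t := hF.ge_of_tendsto hF1 t
  obtain ⟨hG0t, hG1t⟩ := hG01 n t
  rcases lt_or_ge t a with hta | hta
  · have hGa := hG n hta.le
    have hFa := hF hta.le
    rw [abs_le]
    constructor <;> linarith
  rcases lt_or_ge b t with htb | htb
  · have hGb := hG n htb.le
    have hFb := hF htb.le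
    rw [abs_le]
    constructor <;> linarith
  · rw [abs_sub_comm]
    exact (hab t ⟨hta, htb⟩).le

theorem continuous_cdf {μ : Measure ℝ} [IsProbabilityMeasure μ] [NullSingletonClass μ] :
    Continuous (cdf μ) := by
  refine continuous_iff_continuousAt.2 fun t => ?_
  have hatom : (cdf μ).measure {t} = 0 := by rw [measure_cdf, measure_singleton]
  rw [StieltjesFunction.measure_singleton, ENNReal.ofReal_eq_zero] at hatom
  have hleft : Function.leftLim (cdf μ) t = cdf μ t :=
    le_antisymm ((monotone_cdf _).leftLim_le le_rfl) (by linarith)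
  exact (monotone_cdf μ).continuousAt_iff_leftLim_eq_rightLim.2
    (by rw [hleft, StieltjesFunction.rightLim_eq])

variable {Ω : ℕ → Type*} {Ω' : Type*} [∀ n, MeasurableSpace (Ω n)] [MeasurableSpace Ω']
  {P : (n : ℕ) → Measure (Ω n)} [∀ n, IsProbabilityMeasure (P n)] {Q : Measure Ω'}
  [IsProbabilityMeasure Q] {X : (n : ℕ) → Ω n → ℝ} {Z : Ω' → ℝ}

theorem tendsto_iSup_abs_sub_of_tendstoInDistribution (h : TendstoInDistribution X atTop Z P Q)
    [NullSingletonClass (Q.map Z)] :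
    Tendsto (fun n => ⨆ t : ℝ, |(P n).real {ω | X n ω ≤ t} - Q.real {ω | Z ω ≤ t}|)
      atTop (𝓝 0) := by
  have hX := h.forall_aemeasurable
  have hZ := h.aemeasurable_limit
  have hmapP (n : ℕ) : IsProbabilityMeasure ((P n).map (X n)) :=
    Measure.isProbabilityMeasure_map (hX n)
  have hmapQ : IsProbabilityMeasure (Q.map Z) := Measure.isProbabilityMeasure_map hZ
  have hcdfX (n : ℕ) (t : ℝ) : (P n).real {ω | X n ω ≤ t} = cdf ((P n).map (X n)) t := by
    rw [cdf_eq_real, map_measureReal_apply_of_aemeasurable (hX n) measurableSet_Iic]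
    rfl
  have hcdfZ (t : ℝ) : Q.real {ω | Z ω ≤ t} = cdf (Q.map Z) t := by
    rw [cdf_eq_real, map_measureReal_apply_of_aemeasurable hZ measurableSet_Iic]
    rfl
  have hlim (t : ℝ) : Tendsto (fun n => cdf ((P n).map (X n)) t) atTop (𝓝 (cdf (Q.map Z) t)) := by
    simp only [cdf_eq_real, measureReal_def]
    exact (ENNReal.tendsto_toReal (measure_ne_top _ _)).comp
      (ProbabilityMeasure.tendsto_measure_of_null_frontier_of_tendsto' h.tendsto (E := Iic t)
        (by rw [frontier_Iic]; exact measure_singleton (μ := Q.map Z) t))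
  simp only [hcdfX, hcdfZ]
  refine Metric.tendsto_nhds.2 fun η hη => ?_
  filter_upwards [eventually_forall_abs_sub_le_of_monotone (monotone_cdf _) continuous_cdf
    (tendsto_cdf_atBot _) (tendsto_cdf_atTop _) (fun n => monotone_cdf ((P n).map (X n)))
    (fun n t => ⟨cdf_nonneg _ t, cdf_le_one _ t⟩) hlim (half_pos hη)] with n hn
  rw [Real.dist_eq, sub_zero, abs_of_nonneg (Real.iSup_nonneg fun t => abs_nonneg _)]
  exact (ciSup_le hn).trans_lt (half_lt_self hη)

end Polya

/-! ## Resampling with replacement -/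

section Resampling

variable {k : ℕ}

theorem sum_eq_mul_mean (hk : k ≠ 0) (y : Fin k → ℝ) : ∑ i, y i = k * mean y := by
  rw [mean, mul_div_cancel₀ _ (Nat.cast_ne_zero.2 hk)]

theorem isProbabilityMeasure_uniformOn_univ_fin (hk : k ≠ 0) :
    IsProbabilityMeasure (uniformOn (univ : Set (Fin k))) :=
  have : NeZero k := ⟨hk⟩
  isProbabilityMeasure_uniformOn finite_univ univ_nonempty

theorem integral_uniformOn_univ_fin (y : Fin k → ℝ) :
    ∫ i, y i ∂(uniformOn (univ : Set (Fin k))) = mean y := by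
  rcases eq_or_ne k 0 with rfl | hk
  · simp [mean, Measure.eq_zero_of_isEmpty]
  have := isProbabilityMeasure_uniformOn_univ_fin hk
  rw [integral_fintype .of_finite, mean, Finset.sum_div]
  refine Finset.sum_congr rfl fun i _ => ?_
  rw [measureReal_def, uniformOn_univ]
  simp [div_eq_inv_mul]

theorem sum_eq_mul_integral_uniformOn (hk : k ≠ 0) (y : Fin k → ℝ) :
    ∑ i, y i = k * ∫ i, y i ∂(uniformOn (univ : Set (Fin k))) := by
  rw [integral_uniformOn_univ_fin, sum_eq_mul_mean hk]

theorem integral_exp_sum_bootstrapMeasure (hk : k ≠ 0) (w : Fin 2 → Fin k → ℝ) :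
    ∫ r, Complex.exp ((∑ j, ∑ i, w j (r (j, i)) : ℝ) * Complex.I) ∂(bootstrapMeasure k) =
      ∏ j, (∫ i, Complex.exp (w j i * Complex.I) ∂(uniformOn (univ : Set (Fin k)))) ^ k := by
  have := isProbabilityMeasure_uniformOn_univ_fin hk
  have hprod (r : Resample k) : Complex.exp ((∑ j, ∑ i, w j (r (j, i)) : ℝ) * Complex.I) =
      ∏ ji : Fin 2 × Fin k, Complex.exp (w ji.1 (r ji) * Complex.I) := by
    rw [← Complex.exp_sum, ← Finset.sum_mul, ← Complex.ofReal_sum, Fintype.sum_prod_type]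
  simp_rw [hprod]
  refine (integral_fintype_prod_eq_prod
    (f := fun (ji : Fin 2 × Fin k) i => Complex.exp (w ji.1 i * Complex.I))).trans ?_
  simp [Fintype.prod_prod_type]

theorem integral_comp_eval_bootstrapMeasure (hk : k ≠ 0) (w : Fin k → ℝ) (j : Fin 2)
    (i : Fin k) : ∫ r, w (r (j, i)) ∂(bootstrapMeasure k) = mean w := by
  have := isProbabilityMeasure_uniformOn_univ_fin hk
  have heval := measurePreserving_eval
    (fun _ : Fin 2 × Fin k => uniformOn (univ : Set (Fin k))) (j, i)
  rw [← integral_uniformOn_univ_fin, ← heval.map_eq, integral_map heval.measurable.aemeasurable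
    (measurable_of_finite w).aestronglyMeasurable]
  rfl

theorem variance_sum_comp_eval_bootstrapMeasure (hk : k ≠ 0) {w : Fin k → ℝ}
    (hw : ∑ i, w i = 0) (j : Fin 2) :
    Var[fun r : Resample k => ∑ i, w (r (j, i)); bootstrapMeasure k] = ∑ i, w i ^ 2 := by
  have := isProbabilityMeasure_uniformOn_univ_fin hk
  have hindep : iIndepFun (fun (ji : Fin 2 × Fin k) (r : Resample k) => w (r ji))
      (bootstrapMeasure k) :=
    iIndepFun_pi (X := fun _ v => w v) fun _ => (measurable_of_finite w).aemeasurable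
  have hvar (i : Fin k) : Var[fun r : Resample k => w (r (j, i)); bootstrapMeasure k] =
      mean fun i => w i ^ 2 := by
    have hmean : mean w = 0 := by rw [mean, hw, zero_div]
    rw [variance_eq_sub MemLp.of_discrete, integral_comp_eval_bootstrapMeasure hk, hmean]
    simpa using integral_comp_eval_bootstrapMeasure hk (fun v => w v ^ 2) j i
  have hsum := IndepFun.variance_sum (μ := bootstrapMeasure k)
    (X := fun (i : Fin k) (r : Resample k) => w (r (j, i))) (s := Finset.univ)
    (fun i _ => MemLp.of_discrete) fun a _ b _ hab =>
      hindep.indepFun (i := (j, a)) (j := (j, b)) (by simpa using hab)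
  have hfun : (fun r : Resample k => ∑ i, w (r (j, i))) = ∑ i, fun r : Resample k => w (r (j, i)) :=
    (Finset.sum_fn _ _).symm
  rw [hfun, hsum]
  simp only [hvar, Finset.sum_const, Finset.card_univ, Fintype.card_fin, nsmul_eq_mul]
  rw [← sum_eq_mul_mean hk]

theorem bootstrapMeasure_real_le_abs_sum_le (hk : k ≠ 0) {w : Fin k → ℝ} (hw : ∑ i, w i = 0)
    (j : Fin 2) {τ : ℝ} (hτ : 0 < τ) :
    (bootstrapMeasure k).real {r | τ ≤ |∑ i, w (r (j, i))|} ≤ (∑ i, w i ^ 2) / τ ^ 2 := by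
  have hmean : ∫ r : Resample k, ∑ i, w (r (j, i)) ∂(bootstrapMeasure k) = 0 := by
    rw [integral_finsetSum _ fun i _ => Integrable.of_finite]
    simp only [integral_comp_eval_bootstrapMeasure hk, mean, hw, zero_div, Finset.sum_const_zero]
  have hcheb := meas_ge_le_variance_div_sq (μ := bootstrapMeasure k)
    (X := fun r : Resample k => ∑ i, w (r (j, i))) MemLp.of_discrete hτ
  rw [hmean, variance_sum_comp_eval_bootstrapMeasure hk hw] at hcheb
  simp only [sub_zero] at hcheb
  exact ENNReal.toReal_le_of_le_ofReal (by positivity) hcheb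

end Resampling

theorem integral_exp_mul_gaussianReal (c s : ℝ) :
    ∫ z, Complex.exp ((s * (c * z) : ℝ) * Complex.I) ∂(gaussianReal 0 1) =
      Complex.exp ((-(c ^ 2 * s ^ 2 / 2) : ℝ) : ℂ) := by
  rw [← charFun_map_eq_integral_exp_mul_I (by fun_prop) s, gaussianReal_map_const_mul,
    charFun_gaussianReal]
  congr 1
  push_cast
  simp

theorem tendstoInDistribution_sum_bootstrapMeasure {k : ℕ → ℕ} {w : (n : ℕ) → Fin 2 → Fin (k n) → ℝ}
    {v c : ℝ} (hk : Tendsto k atTop atTop) (hw : ∀ n j, ∑ i, w n j i = 0)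
    (hsq : ∀ j, Tendsto (fun n => ∑ i, w n j i ^ 2) atTop (𝓝 v))
    (hcube : ∀ j, Tendsto (fun n => ∑ i, |w n j i| ^ 3) atTop (𝓝 0)) (hc : c ^ 2 = 2 * v) :
    TendstoInDistribution (fun n (r : Resample (k n)) => ∑ j, ∑ i, w n j (r (j, i))) atTop
      (fun z : ℝ => c * z) (fun n => bootstrapMeasure (k n)) (gaussianReal 0 1) := by
  refine (tendstoInDistribution_iff_tendsto_integral_exp_mul_I
    (fun n => (measurable_of_finite _).aemeasurable) (by fun_prop)).2 fun s => ?_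
  rw [integral_exp_mul_gaussianReal]
  have hk0 : ∀ᶠ n in atTop, k n ≠ 0 := hk.eventually_ne_atTop 0
  have hfactor (j : Fin 2) : Tendsto (fun n => (∫ i, Complex.exp ((s * w n j i : ℝ) * Complex.I)
      ∂(uniformOn (univ : Set (Fin (k n))))) ^ k n) atTop
      (𝓝 (Complex.exp ((-(s ^ 2 * v / 2) : ℝ) : ℂ))) := by
    refine tendsto_integral_exp_mul_I_pow hk
      (hk0.mono fun n hn => isProbabilityMeasure_uniformOn_univ_fin hn)
      (fun n => MemLp.of_discrete) (fun n => ?_)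
      (((hsq j).const_mul (s ^ 2)).congr' (hk0.mono fun n hn => ?_)) ?_
    · rw [integral_const_mul, integral_uniformOn_univ_fin, mean, hw, zero_div, mul_zero]
    · simp only [← sum_eq_mul_integral_uniformOn hn, Finset.mul_sum, mul_pow]
    · have hscaled := (hcube j).const_mul (|s| ^ 3)
      rw [mul_zero] at hscaled
      refine hscaled.congr' (hk0.mono fun n hn => ?_)
      simp only [← sum_eq_mul_integral_uniformOn hn, Finset.mul_sum, abs_mul, mul_pow]
  have hlim : Complex.exp ((-(c ^ 2 * s ^ 2 / 2) : ℝ) : ℂ) =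
      ∏ _j : Fin 2, Complex.exp ((-(s ^ 2 * v / 2) : ℝ) : ℂ) := by
    rw [Fin.prod_univ_two, ← Complex.exp_add, ← Complex.ofReal_add, hc]
    congr 2
    ring
  rw [hlim]
  refine (tendsto_finsetProd _ fun j _ => hfactor j).congr' (hk0.mono fun n hn => ?_)
  simp only [Finset.mul_sum]
  exact (integral_exp_sum_bootstrapMeasure hn fun j i => s * w n j i).symm

/-! ## Bootstrapping the inverse of a least squares line -/

section Mean

variable {k : ℕ}

theorem mean_const_add (hk : k ≠ 0) (c : ℝ) (y : Fin k → ℝ) :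
    mean (fun i => c + y i) = c + mean y := by
  have hk' : (k : ℝ) ≠ 0 := Nat.cast_ne_zero.2 hk
  simp only [mean, Finset.sum_add_distrib, Finset.sum_const, Finset.card_univ, Fintype.card_fin,
    nsmul_eq_mul]
  field_simp

theorem sum_sub_mean (y : Fin k → ℝ) : ∑ i, (y i - mean y) = 0 := by
  rcases eq_or_ne k 0 with rfl | hk
  · simp
  rw [Finset.sum_sub_distrib, sum_eq_mul_mean hk]
  simp

theorem mean_sub_mean_sq (hk : k ≠ 0) (y : Fin k → ℝ) :
    mean (fun i => (y i - mean y) ^ 2) = mean (fun i => y i ^ 2) - mean y ^ 2 := by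
  have hk' : (k : ℝ) ≠ 0 := Nat.cast_ne_zero.2 hk
  have hsq (i : Fin k) : (y i - mean y) ^ 2 = y i ^ 2 - 2 * mean y * y i + mean y ^ 2 := by ring
  have hsum : ∑ i, (y i - mean y) ^ 2 = k * (mean (fun i => y i ^ 2) - mean y ^ 2) := by
    simp only [hsq, Finset.sum_add_distrib, Finset.sum_sub_distrib, ← Finset.mul_sum,
      sum_eq_mul_mean hk y, sum_eq_mul_mean hk (fun i => y i ^ 2), Finset.sum_const,
      Finset.card_univ, Fintype.card_fin, nsmul_eq_mul]
    ring
  rw [mean, hsum, mul_div_cancel_left₀ _ hk']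

theorem mean_abs_sub_mean_cube_le (hk : k ≠ 0) (y : Fin k → ℝ) :
    mean (fun i => |y i - mean y| ^ 3) ≤ 4 * (|mean y| ^ 3 + mean fun i => |y i| ^ 3) := by
  rw [← mean_const_add hk]
  unfold mean
  rw [← mul_div_assoc, Finset.mul_sum]
  gcongr with i
  calc |y i - mean y| ^ 3 ≤ (|y i| + |mean y|) ^ 3 := by gcongr; exact abs_sub _ _
    _ ≤ 2 ^ 2 * (|y i| ^ 3 + |mean y| ^ 3) := add_pow_le (abs_nonneg _) (abs_nonneg _) 3
    _ = 4 * (|mean y| ^ 3 + |y i| ^ 3) := by ring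

/-- The contribution of the `i`-th observation, each time it is drawn, to `s` times the bootstrap
error of the mean of `y`. -/
noncomputable def scaledDeviation (s : ℝ) (y : Fin k → ℝ) (i : Fin k) : ℝ := s / k * (y i - mean y)

theorem sum_scaledDeviation (s : ℝ) (y : Fin k → ℝ) : ∑ i, scaledDeviation s y i = 0 := by
  simp only [scaledDeviation, ← Finset.mul_sum, sum_sub_mean, mul_zero]

theorem sum_scaledDeviation_comp (hk : k ≠ 0) (s : ℝ) (y : Fin k → ℝ) (π : Fin k → Fin k) :
    ∑ i, scaledDeviation s y (π i) = s * (mean (fun i => y (π i)) - mean y) := by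
  have hk' : (k : ℝ) ≠ 0 := Nat.cast_ne_zero.2 hk
  simp only [scaledDeviation, ← Finset.mul_sum, Finset.sum_sub_distrib,
    sum_eq_mul_mean hk fun i => y (π i), Finset.sum_const, Finset.card_univ, Fintype.card_fin,
    nsmul_eq_mul]
  field_simp

theorem scaledDeviation_const_add (hk : k ≠ 0) (s c : ℝ) (y : Fin k → ℝ) :
    scaledDeviation s (fun i => c + y i) = scaledDeviation s y := by
  ext i
  rw [scaledDeviation, mean_const_add hk, add_sub_add_left_eq_sub, scaledDeviation]

theorem sum_scaledDeviation_sq (hk : k ≠ 0) (s : ℝ) (y : Fin k → ℝ) :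
    ∑ i, scaledDeviation s y i ^ 2 = s ^ 2 / k * (mean (fun i => y i ^ 2) - mean y ^ 2) := by
  have hk' : (k : ℝ) ≠ 0 := Nat.cast_ne_zero.2 hk
  simp only [scaledDeviation, mul_pow, ← Finset.mul_sum]
  rw [sum_eq_mul_mean hk, mean_sub_mean_sq hk]
  field_simp

theorem sum_abs_scaledDeviation_cube_le (hk : k ≠ 0) (s : ℝ) (y : Fin k → ℝ) :
    ∑ i, |scaledDeviation s y i| ^ 3 ≤
      |s| ^ 3 / k ^ 2 * (4 * (|mean y| ^ 3 + mean fun i => |y i| ^ 3)) := by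
  have hk' : (k : ℝ) ≠ 0 := Nat.cast_ne_zero.2 hk
  calc ∑ i, |scaledDeviation s y i| ^ 3
      = |s| ^ 3 / k ^ 2 * mean fun i => |y i - mean y| ^ 3 := by
        simp only [scaledDeviation, abs_mul, mul_pow, ← Finset.mul_sum, abs_div, Nat.abs_cast]
        rw [sum_eq_mul_mean hk]
        field_simp
    _ ≤ _ := by gcongr; exact mean_abs_sub_mean_cube_le hk y

end Mean

section Linearization

variable {k : ℕ} {θ L U : ℝ}

theorem lsInverse_eq {y z : Fin k → ℝ} (h : lsSlope L U y z ≠ 0) :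
    lsInverse θ L U y z = (L + U) / 2 + (θ - (mean y + mean z) / 2) / lsSlope L U y z := by
  unfold lsInverse lsIntercept
  field_simp
  ring

theorem lsSlope_sub_lsSlope (y z y' z' : Fin k → ℝ) : lsSlope L U y' z' - lsSlope L U y z =
    ((mean z' - mean z) - (mean y' - mean y)) / (U - L) := by
  unfold lsSlope
  ring

theorem lsInverse_sub_lsInverse {y z y' z' : Fin k → ℝ} (h : lsSlope L U y z ≠ 0)
    (h' : lsSlope L U y' z' ≠ 0) : lsInverse θ L U y' z' - lsInverse θ L U y z =
      -((mean y' - mean y) + (mean z' - mean z)) / (2 * lsSlope L U y' z') -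
        (θ - (mean y + mean z) / 2) / (U - L) * ((mean z' - mean z) - (mean y' - mean y)) /
          (lsSlope L U y z * lsSlope L U y' z') := by
  have hsub := lsSlope_sub_lsSlope (L := L) (U := U) y z y' z'
  rw [lsInverse_eq h, lsInverse_eq h', div_mul_eq_mul_div, mul_div_assoc _ _ (U - L), ← hsub]
  field_simp
  ring

theorem abs_linearization_error_le {a c b β β' ω M : ℝ} (hb : 0 < b) (hβ : b / 2 ≤ β)
    (hβ' : b / 2 ≤ β') (ha : |a| ≤ M) (hc : |c| ≤ M) :
    |-(a + c) / (2 * β') - ω * (c - a) / (β * β') + (a + c) / (2 * b)| ≤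
      M / b ^ 2 * (2 * |β' - b| + 8 * |ω|) := by
  have hβ0 : 0 < β := (half_pos hb).trans_le hβ
  have hβ'0 : 0 < β' := (half_pos hb).trans_le hβ'
  have hM : 0 ≤ M := (abs_nonneg a).trans ha
  have hadd : |a + c| ≤ 2 * M := by linarith [abs_add_le a c]
  have hsub : |c - a| ≤ 2 * M := by linarith [abs_sub c a]
  calc _ = |(a + c) * (β' - b) / (2 * b * β') + -(ω * (c - a) / (β * β'))| := by
        congr 1
        field_simp
        ring
    _ ≤ |a + c| * |β' - b| / (2 * b * β') + |ω| * |c - a| / (β * β') := by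
        refine (abs_add_le _ _).trans_eq ?_
        rw [abs_neg, abs_div, abs_div, abs_mul (a + c), abs_mul ω,
          abs_of_pos (show 0 < 2 * b * β' by positivity),
          abs_of_pos (show 0 < β * β' by positivity)]
    _ ≤ 2 * M * |β' - b| / (2 * b * (b / 2)) + |ω| * (2 * M) / (b / 2 * (b / 2)) := by gcongr
    _ = M / b ^ 2 * (2 * |β' - b| + 8 * |ω|) := by
        field_simp
        ring

theorem abs_mul_lsInverse_sub_add_le {y z y' z' : Fin k → ℝ} {s b M : ℝ} (hs : 0 < s)
    (hLU : L < U) (hb : 0 < b) (hy : |s * (mean y' - mean y)| ≤ M)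
    (hz : |s * (mean z' - mean z)| ≤ M) (hslope : |lsSlope L U y z - b| ≤ b / 4)
    (hM : 2 * M / (s * (U - L)) ≤ b / 4) :
    |s * (lsInverse θ L U y' z' - lsInverse θ L U y z) +
        (s * (mean y' - mean y) + s * (mean z' - mean z)) / (2 * b)| ≤
      M / b ^ 2 * (2 * (2 * M / (s * (U - L)) + |lsSlope L U y z - b|) +
        8 * |(θ - (mean y + mean z) / 2) / (U - L)|) := by
  have hgap : 0 < U - L := sub_pos.2 hLU
  have hM0 : 0 ≤ M := (abs_nonneg _).trans hy
  have hdiff : |lsSlope L U y' z' - lsSlope L U y z| ≤ 2 * M / (s * (U - L)) := by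
    rw [lsSlope_sub_lsSlope, le_div_iff₀ (by positivity), abs_div, abs_of_pos hgap,
      div_mul_eq_mul_div, mul_left_comm, ← mul_assoc, mul_div_cancel_right₀ _ hgap.ne',
      ← abs_of_pos hs, ← abs_mul, mul_sub]
    linarith [abs_sub (s * (mean z' - mean z)) (s * (mean y' - mean y))]
  have hslope' : |lsSlope L U y' z' - b| ≤ 2 * M / (s * (U - L)) + |lsSlope L U y z - b| :=
    (abs_sub_le _ (lsSlope L U y z) _).trans (by gcongr)
  have hβ : b / 2 ≤ lsSlope L U y z := by linarith [(abs_le.1 hslope).1]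
  have hβ' : b / 2 ≤ lsSlope L U y' z' := by
    linarith [(abs_le.1 hslope').1]
  calc _ = |-(s * (mean y' - mean y) + s * (mean z' - mean z)) / (2 * lsSlope L U y' z') -
        (θ - (mean y + mean z) / 2) / (U - L) *
          (s * (mean z' - mean z) - s * (mean y' - mean y)) /
            (lsSlope L U y z * lsSlope L U y' z') +
        (s * (mean y' - mean y) + s * (mean z' - mean z)) / (2 * b)| := by
        rw [lsInverse_sub_lsInverse (by linarith) (by linarith)]
        congr 1
        ring
    _ ≤ _ := abs_linearization_error_le hb hβ hβ' hy hz
    _ ≤ _ := by gcongr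

end Linearization

section Consistency

variable {k : ℕ → ℕ} {L U s : ℕ → ℝ} {Y : (n : ℕ) → Fin 2 → Fin (k n) → ℝ} {θ b q : ℝ}

theorem tendsto_lsSlope
    (h0 : Tendsto (fun n => (mean (Y n 0) - θ) / (U n - L n)) atTop (𝓝 (-(b / 2))))
    (h1 : Tendsto (fun n => (mean (Y n 1) - θ) / (U n - L n)) atTop (𝓝 (b / 2))) :
    Tendsto (fun n => lsSlope (L n) (U n) (Y n 0) (Y n 1)) atTop (𝓝 b) := by
  have h := h1.sub h0
  rw [sub_neg_eq_add, add_halves] at h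
  refine h.congr fun n => ?_
  rw [← sub_div, sub_sub_sub_cancel_right, lsSlope]

theorem tendsto_sub_average_div
    (h0 : Tendsto (fun n => (mean (Y n 0) - θ) / (U n - L n)) atTop (𝓝 (-(b / 2))))
    (h1 : Tendsto (fun n => (mean (Y n 1) - θ) / (U n - L n)) atTop (𝓝 (b / 2))) :
    Tendsto (fun n => (θ - (mean (Y n 0) + mean (Y n 1)) / 2) / (U n - L n)) atTop (𝓝 0) := by
  have h := ((h0.add h1).div_const 2).neg
  rw [neg_add_cancel, zero_div, neg_zero] at h
  refine h.congr fun n => ?_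
  ring

theorem eventually_abs_bootstrap_lsInverse_sub_le (hk : Tendsto k atTop atTop)
    (hLU : ∀ᶠ n in atTop, L n < U n) (hs : Tendsto (fun n => s n * (U n - L n)) atTop atTop)
    (hb : 0 < b) (h0 : Tendsto (fun n => (mean (Y n 0) - θ) / (U n - L n)) atTop (𝓝 (-(b / 2))))
    (h1 : Tendsto (fun n => (mean (Y n 1) - θ) / (U n - L n)) atTop (𝓝 (b / 2))) (M : ℝ) {η : ℝ}
    (hη : 0 < η) : ∀ᶠ n in atTop, ∀ r : Resample (k n),
      (∀ j, |∑ i, scaledDeviation (s n) (Y n j) (r (j, i))| ≤ M) →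
      |s n * (lsInverse θ (L n) (U n) (fun i => Y n 0 (r (0, i))) (fun i => Y n 1 (r (1, i))) -
          lsInverse θ (L n) (U n) (Y n 0) (Y n 1)) -
        ∑ j, ∑ i, -scaledDeviation (s n) (Y n j) (r (j, i)) / (2 * b)| ≤ η := by
  have hslope : Tendsto (fun n => |lsSlope (L n) (U n) (Y n 0) (Y n 1) - b|) atTop (𝓝 0) := by
    simpa using ((tendsto_lsSlope h0 h1).sub_const b).abs
  have hgap := (tendsto_sub_average_div h0 h1).abs
  rw [abs_zero] at hgap
  have hMs : Tendsto (fun n => 2 * M / (s n * (U n - L n))) atTop (𝓝 0) := hs.const_div_atTop _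
  have hbound := (((hMs.add hslope).const_mul 2).add (hgap.const_mul 8)).const_mul (M / b ^ 2)
  simp only [add_zero, mul_zero] at hbound
  filter_upwards [hLU, hs.eventually_gt_atTop 0, hk.eventually_ne_atTop 0,
    hslope.eventually_le_const (by positivity : 0 < b / 4),
    hMs.eventually_le_const (by positivity : 0 < b / 4), hbound.eventually_le_const hη]
    with n hLUn hsn hkn hslopen hMsn hboundn r hr
  have hs0 : 0 < s n := pos_of_mul_pos_left hsn (sub_pos.2 hLUn).le
  have hsum (j : Fin 2) : ∑ i, scaledDeviation (s n) (Y n j) (r (j, i)) =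
      s n * (mean (fun i => Y n j (r (j, i))) - mean (Y n j)) :=
    sum_scaledDeviation_comp hkn _ _ fun i => r (j, i)
  have hlin : ∑ j, ∑ i, -scaledDeviation (s n) (Y n j) (r (j, i)) / (2 * b) =
      -((s n * (mean (fun i => Y n 0 (r (0, i))) - mean (Y n 0)) +
        s n * (mean (fun i => Y n 1 (r (1, i))) - mean (Y n 1))) / (2 * b)) := by
    simp only [← Finset.sum_div, Finset.sum_neg_distrib, hsum, Fin.sum_univ_two]
    ring
  rw [hlin, sub_neg_eq_add]
  exact (abs_mul_lsInverse_sub_add_le hs0 hLUn hb (hsum 0 ▸ hr 0) (hsum 1 ▸ hr 1) hslopen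
    hMsn).trans hboundn

theorem exists_eventually_bootstrapMeasure_real_le (hk : Tendsto k atTop atTop)
    (hsq : ∀ j, Tendsto (fun n => ∑ i, scaledDeviation (s n) (Y n j) i ^ 2) atTop (𝓝 q)) {η : ℝ}
    (hη : 0 < η) : ∃ M, ∀ᶠ n in atTop, (bootstrapMeasure (k n)).real
      {r | ¬ ∀ j, |∑ i, scaledDeviation (s n) (Y n j) (r (j, i))| ≤ M} ≤ η := by
  have hq : 0 ≤ q := ge_of_tendsto' (hsq 0) fun n => Finset.sum_nonneg fun i _ => sq_nonneg _
  refine ⟨√(2 * (q + 1) / η), ?_⟩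
  set M := √(2 * (q + 1) / η) with hMdef
  have hM : 0 < M := Real.sqrt_pos.2 (by positivity)
  have hMsq : (q + 1) / M ^ 2 = η / 2 := by
    rw [hMdef, Real.sq_sqrt (by positivity)]
    field_simp
  have hsq' : ∀ᶠ n in atTop, ∀ j, ∑ i, scaledDeviation (s n) (Y n j) i ^ 2 ≤ q + 1 :=
    eventually_all.2 fun j => (hsq j).eventually_le_const (lt_add_one q)
  filter_upwards [hsq', hk.eventually_ne_atTop 0] with n hn hkn
  have hcheb (j : Fin 2) : (bootstrapMeasure (k n)).real
      {r | M ≤ |∑ i, scaledDeviation (s n) (Y n j) (r (j, i))|} ≤ η / 2 :=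
    (bootstrapMeasure_real_le_abs_sum_le hkn (sum_scaledDeviation _ _) j hM).trans
      (hMsq ▸ by gcongr; exact hn j)
  calc _ ≤ (bootstrapMeasure (k n)).real
        ({r | M ≤ |∑ i, scaledDeviation (s n) (Y n 0) (r (0, i))|} ∪
          {r | M ≤ |∑ i, scaledDeviation (s n) (Y n 1) (r (1, i))|}) := by
        refine measureReal_mono (fun r hr => ?_)
        obtain ⟨j, hj⟩ := not_forall.1 hr
        fin_cases j
        · exact Or.inl (not_le.1 hj).le
        · exact Or.inr (not_le.1 hj).le
    _ ≤ η / 2 + η / 2 := (measureReal_union_le _ _).trans (add_le_add (hcheb 0) (hcheb 1))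
    _ = η := add_halves η

theorem tendstoInDistribution_bootstrap_lsInverse {c : ℝ} (hk : Tendsto k atTop atTop)
    (hLU : ∀ᶠ n in atTop, L n < U n) (hs : Tendsto (fun n => s n * (U n - L n)) atTop atTop)
    (hb : 0 < b) (h0 : Tendsto (fun n => (mean (Y n 0) - θ) / (U n - L n)) atTop (𝓝 (-(b / 2))))
    (h1 : Tendsto (fun n => (mean (Y n 1) - θ) / (U n - L n)) atTop (𝓝 (b / 2)))
    (hsq : ∀ j, Tendsto (fun n => ∑ i, scaledDeviation (s n) (Y n j) i ^ 2) atTop (𝓝 q))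
    (hcube : ∀ j, Tendsto (fun n => ∑ i, |scaledDeviation (s n) (Y n j) i| ^ 3) atTop (𝓝 0))
    (hc : c ^ 2 = q / (2 * b ^ 2)) :
    TendstoInDistribution (fun n (r : Resample (k n)) =>
        s n * (lsInverse θ (L n) (U n) (fun i => Y n 0 (r (0, i))) (fun i => Y n 1 (r (1, i))) -
          lsInverse θ (L n) (U n) (Y n 0) (Y n 1))) atTop
      (fun z : ℝ => c * z) (fun n => bootstrapMeasure (k n)) (gaussianReal 0 1) := by
  have hlinear : TendstoInDistribution
      (fun n (r : Resample (k n)) => ∑ j, ∑ i, -scaledDeviation (s n) (Y n j) (r (j, i)) / (2 * b))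
      atTop (fun z : ℝ => c * z) (fun n => bootstrapMeasure (k n)) (gaussianReal 0 1) := by
    refine tendstoInDistribution_sum_bootstrapMeasure (v := q / (2 * b) ^ 2)
      (w := fun n j i => -scaledDeviation (s n) (Y n j) i / (2 * b)) hk
      (fun n j => ?_) (fun j => ?_) (fun j => ?_) (by rw [hc]; field_simp)
    · rw [← Finset.sum_div, Finset.sum_neg_distrib, sum_scaledDeviation, neg_zero, zero_div]
    · simpa only [div_pow, neg_sq, Finset.sum_div] using (hsq j).div_const ((2 * b) ^ 2)
    · simpa only [abs_div, abs_neg, div_pow, Finset.sum_div, zero_div] using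
        (hcube j).div_const (|2 * b| ^ 3)
  refine tendstoInDistribution_of_tendstoInDistribution_of_sub hlinear
    (fun n => (measurable_of_finite _).aemeasurable) fun η hη => ?_
  obtain ⟨M, hM⟩ := exists_eventually_bootstrapMeasure_real_le hk hsq hη
  filter_upwards [hM,
    eventually_abs_bootstrap_lsInverse_sub_le hk hLU hs hb h0 h1 M hη] with n hMn hn
  exact (measureReal_mono fun r hr hsmall => not_le.2 hr (hn r hsmall)).trans hMn

end Consistency

section ScaledDeviation

variable {k : ℕ → ℕ} {s : ℕ → ℝ} (c : ℕ → ℝ) {y : (n : ℕ) → Fin (k n) → ℝ} {ρ m v κ : ℝ}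

theorem tendsto_sum_scaledDeviation_const_add_sq (hk : Tendsto k atTop atTop)
    (hs : Tendsto (fun n => s n ^ 2 / k n) atTop (𝓝 ρ))
    (hmean : Tendsto (fun n => mean (y n)) atTop (𝓝 m))
    (hsq : Tendsto (fun n => mean fun i => y n i ^ 2) atTop (𝓝 v)) :
    Tendsto (fun n => ∑ i, scaledDeviation (s n) (fun i => c n + y n i) i ^ 2) atTop
      (𝓝 (ρ * (v - m ^ 2))) := by
  refine (hs.mul (hsq.sub (hmean.pow 2))).congr' ((hk.eventually_ne_atTop 0).mono fun n hn => ?_)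
  simp only [scaledDeviation_const_add hn, sum_scaledDeviation_sq hn]

theorem tendsto_sum_abs_scaledDeviation_const_add_cube (hk : Tendsto k atTop atTop)
    (hs : Tendsto (fun n => s n ^ 2 / k n) atTop (𝓝 ρ))
    (hmean : Tendsto (fun n => mean (y n)) atTop (𝓝 m))
    (hcube : Tendsto (fun n => mean fun i => |y n i| ^ 3) atTop (𝓝 κ)) :
    Tendsto (fun n => ∑ i, |scaledDeviation (s n) (fun i => c n + y n i) i| ^ 3) atTop (𝓝 0) := by
  have hroot : Tendsto (fun n => √(k n)) atTop atTop :=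
    Real.tendsto_sqrt_atTop.comp (tendsto_natCast_atTop_atTop.comp hk)
  have hscale : Tendsto (fun n => |s n| ^ 3 / (k n : ℝ) ^ 2) atTop (𝓝 0) := by
    have h := (hs.sqrt.pow 3).mul hroot.inv_tendsto_atTop
    rw [mul_zero] at h
    refine h.congr fun n => ?_
    rw [Pi.inv_apply, Real.sqrt_div (sq_nonneg _), Real.sqrt_sq_eq_abs, div_pow, ← div_eq_mul_inv,
      div_div, ← pow_succ, show 3 + 1 = 2 * 2 from rfl, pow_mul, Real.sq_sqrt (Nat.cast_nonneg _)]
  have hbound := hscale.mul (((hmean.abs.pow 3).add hcube).const_mul 4)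
  rw [zero_mul] at hbound
  refine squeeze_zero' (Eventually.of_forall fun n => by positivity)
    ((hk.eventually_ne_atTop 0).mono fun n hn => ?_) hbound
  simp only [scaledDeviation_const_add hn]
  exact sum_abs_scaledDeviation_cube_le hn _ _

end ScaledDeviation

theorem tendsto_mean_const_add_sub_div {f : ℝ → ℝ} {b c d : ℝ} {k : ℕ → ℕ} {u δ : ℕ → ℝ}
    {y : (n : ℕ) → Fin (k n) → ℝ} (hk : Tendsto k atTop atTop) (hf : HasDerivAt f b d)
    (hδ : Tendsto δ atTop (𝓝 0)) (hδ0 : ∀ᶠ n in atTop, δ n ≠ 0)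
    (hu : Tendsto (fun n => (u n - d) / δ n) atTop (𝓝 c))
    (hy : Tendsto (fun n => mean (y n) / δ n) atTop (𝓝 0)) :
    Tendsto (fun n => (mean (fun i => f (u n) + y n i) - f d) / δ n) atTop (𝓝 (b * c)) := by
  have h := (tendsto_sub_div_of_hasDerivAt hf hδ hδ0 hu).add hy
  rw [add_zero] at h
  refine h.congr' ((hk.eventually_ne_atTop 0).mono fun n hn => ?_)
  simp only [mean_const_add hn]
  ring

/-! ## The second stage -/

theorem HasBoundedSlope.exists_hasSlopeAtLeast {f : ℝ → ℝ} (hf : HasBoundedSlope f) {d₀ : ℝ}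
    (hd₀ : d₀ ∈ Icc (0 : ℝ) 1) : ∃ a > 0, HasSlopeAtLeast f d₀ a := by
  obtain ⟨hd, a, b, ha, hab⟩ := hf
  have hmul {s t : ℝ} (hs : s ∈ Icc (0 : ℝ) 1) (ht : t ∈ Icc (0 : ℝ) 1) (hst : s ≤ t) :
      a * (t - s) ≤ f t - f s := by
    refine (convex_Icc (0 : ℝ) 1).mul_sub_le_image_sub_of_le_deriv hd.continuousOn
      (hd.mono interior_subset) (fun u hu => ?_) s hs t ht hst
    rw [← derivWithin_of_mem_nhds (mem_interior_iff_mem_nhds.1 hu)]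
    exact (hab u (interior_subset hu)).1
  refine ⟨a, ha, fun t ht => ?_⟩
  rcases le_total d₀ t with h | h
  · nlinarith [mul_le_mul_of_nonneg_right (hmul hd₀ ht h) (sub_nonneg.2 h)]
  · nlinarith [mul_le_mul_of_nonneg_right (hmul ht hd₀ h) (sub_nonneg.2 h)]

theorem HasSlopeAtLeast.le_deriv {f : ℝ → ℝ} {d₀ a : ℝ} (hf : HasSlopeAtLeast f d₀ a)
    (hd₀ : d₀ ∈ Ioo (0 : ℝ) 1) (hd : DifferentiableAt ℝ f d₀) : a ≤ deriv f d₀ := by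
  have hslope := hasDerivAt_iff_tendsto_slope.1 hd.hasDerivAt
  refine ge_of_tendsto hslope ?_
  filter_upwards [nhdsWithin_le_nhds (Icc_mem_nhds hd₀.1 hd₀.2), self_mem_nhdsWithin] with t ht hne
  have hpos : 0 < (t - d₀) ^ 2 := by have := sub_ne_zero.2 hne; positivity
  rw [slope_def_field, ← mul_div_mul_right _ _ (sub_ne_zero.2 hne), ← sq, le_div_iff₀ hpos]
  exact hf t ht

/-- Half the distance between the two second-stage sampling points. -/
noncomputable def halfWidth (p K γ : ℝ) (n : ℕ) : ℝ := K * (firstSize p n : ℝ) ^ (-γ)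

section HalfWidth

variable {p K γ : ℝ}

theorem eventually_halfWidth_pos (hp : 0 < p) (hK : 0 < K) :
    ∀ᶠ n in atTop, 0 < halfWidth p K γ n := by
  filter_upwards [eventually_half_mul_le_firstSize hp, eventually_gt_atTop 0] with n hsize hn
  have : (0 : ℝ) < firstSize p n := lt_of_lt_of_le (by positivity) hsize
  unfold halfWidth
  positivity

theorem eventually_mul_rpow_neg_le_halfWidth (hp : p ∈ Ioo (0 : ℝ) 1) (hK : 0 ≤ K) (hγ : 0 ≤ γ) :
    ∀ᶠ n : ℕ in atTop, K * (n : ℝ) ^ (-γ) ≤ halfWidth p K γ n := by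
  filter_upwards [eventually_half_mul_le_firstSize hp.1, eventually_firstSize_le hp,
    eventually_gt_atTop 0] with n hsize hle hn
  have hp0 := hp.1
  have hpos : (0 : ℝ) < firstSize p n := lt_of_lt_of_le (by positivity) hsize
  exact mul_le_mul_of_nonneg_left
    (Real.rpow_le_rpow_of_nonpos hpos (Nat.cast_le.2 hle) (neg_nonpos.2 hγ)) hK

theorem tendsto_halfWidth (hp : 0 < p) (hγ : 0 < γ) :
    Tendsto (halfWidth p K γ) atTop (𝓝 0) := by
  have hsize : Tendsto (fun n : ℕ => (firstSize p n : ℝ)) atTop atTop :=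
    tendsto_atTop_mono' _ (eventually_half_mul_le_firstSize hp)
      (tendsto_natCast_atTop_atTop.const_mul_atTop (half_pos hp))
  have h := ((tendsto_rpow_neg_atTop hγ).comp hsize).const_mul K
  rwa [mul_zero] at h

theorem tendsto_div_halfWidth (hp : p ∈ Ioo (0 : ℝ) 1) (hK : 0 < K) (hγ : 0 ≤ γ) {a : ℕ → ℝ}
    (ha : Tendsto (fun n : ℕ => (n : ℝ) ^ γ * a n) atTop (𝓝 0)) :
    Tendsto (fun n => a n / halfWidth p K γ n) atTop (𝓝 0) := by
  refine squeeze_zero_norm' ?_ (by simpa only [abs_zero, zero_div] using ha.abs.div_const K)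
  filter_upwards [eventually_mul_rpow_neg_le_halfWidth hp hK.le hγ, eventually_gt_atTop 0]
    with n hn h0
  have hn0 : (0 : ℝ) < n := by exact_mod_cast h0
  have hpos : 0 < K * (n : ℝ) ^ (-γ) := by positivity
  calc ‖a n / halfWidth p K γ n‖ = |a n| / halfWidth p K γ n := by
        rw [Real.norm_eq_abs, abs_div, abs_of_pos (hpos.trans_le hn)]
    _ ≤ |a n| / (K * (n : ℝ) ^ (-γ)) := by gcongr
    _ = |(n : ℝ) ^ γ * a n| / K := by
        rw [abs_mul, abs_of_pos (Real.rpow_pos_of_pos hn0 γ), Real.rpow_neg hn0.le]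
        field_simp

theorem tendsto_of_tendsto_div_halfWidth (hp : 0 < p) (hK : 0 < K) (hγ : 0 < γ) {a : ℕ → ℝ}
    (ha : Tendsto (fun n => a n / halfWidth p K γ n) atTop (𝓝 0)) : Tendsto a atTop (𝓝 0) := by
  have h := ha.mul (tendsto_halfWidth (K := K) hp hγ)
  rw [zero_mul] at h
  exact h.congr' ((eventually_halfWidth_pos hp hK).mono fun n hn => div_mul_cancel₀ _ hn.ne')

theorem tendsto_sqrt_mul_halfWidth (hp : p ∈ Ioo (0 : ℝ) 1) (hK : 0 < K) (hγ0 : 0 ≤ γ)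
    (hγ : γ < 1 / 2) : Tendsto (fun n : ℕ => √n * halfWidth p K γ n) atTop atTop := by
  have hpow : Tendsto (fun n : ℕ => K * (n : ℝ) ^ (1 / 2 - γ)) atTop atTop :=
    ((tendsto_rpow_atTop (sub_pos.2 hγ)).comp tendsto_natCast_atTop_atTop).const_mul_atTop hK
  refine tendsto_atTop_mono' _ ?_ hpow
  filter_upwards [eventually_mul_rpow_neg_le_halfWidth hp hK.le hγ0, eventually_gt_atTop 0]
    with n hn h0
  calc K * (n : ℝ) ^ (1 / 2 - γ) = √n * (K * (n : ℝ) ^ (-γ)) := by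
        rw [sub_eq_add_neg, Real.rpow_add (Nat.cast_pos.2 h0), Real.sqrt_eq_rpow]
        ring
    _ ≤ √n * halfWidth p K γ n := by gcongr

end HalfWidth

section SamplingPoints

variable {f : ℝ → ℝ} {d₀ p K γ : ℝ} {x : (m : ℕ) → Fin m → ℝ} {e e' : ℕ → ℕ → ℝ}

theorem upperPoint_sub_lowerPoint (n : ℕ) (e : ℕ → ℝ) :
    upperPoint f d₀ p K γ x n e - lowerPoint f d₀ p K γ x n e = 2 * halfWidth p K γ n := by
  unfold upperPoint lowerPoint halfWidth
  ring

theorem tendsto_lowerPoint_sub_div (hp : 0 < p) (hK : 0 < K) (hd : Tendsto (fun n =>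
      (firstEstimate f d₀ p x n (e n) - d₀) / halfWidth p K γ n) atTop (𝓝 0)) :
    Tendsto (fun n => (lowerPoint f d₀ p K γ x n (e n) - d₀) / (2 * halfWidth p K γ n)) atTop
      (𝓝 (-(1 / 2))) := by
  have h := (hd.sub_const 1).div_const 2
  rw [zero_sub, neg_div] at h
  refine h.congr' ((eventually_halfWidth_pos (γ := γ) hp hK).mono fun n hn => ?_)
  change _ = (firstEstimate f d₀ p x n (e n) - halfWidth p K γ n - d₀) / _
  field_simp
  ring

theorem tendsto_upperPoint_sub_div (hp : 0 < p) (hK : 0 < K) (hd : Tendsto (fun n =>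
      (firstEstimate f d₀ p x n (e n) - d₀) / halfWidth p K γ n) atTop (𝓝 0)) :
    Tendsto (fun n => (upperPoint f d₀ p K γ x n (e n) - d₀) / (2 * halfWidth p K γ n)) atTop
      (𝓝 (1 / 2)) := by
  have h := (hd.add_const 1).div_const 2
  rw [zero_add] at h
  refine h.congr' ((eventually_halfWidth_pos (γ := γ) hp hK).mono fun n hn => ?_)
  change _ = (firstEstimate f d₀ p x n (e n) + halfWidth p K γ n - d₀) / _
  field_simp
  ring

theorem tendsto_mean_add_sub_div_halfWidth (hp : p ∈ Ioo (0 : ℝ) 1) (hK : 0 < K) (hγ : 0 < γ)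
    (hf : DifferentiableAt ℝ f d₀) {u : ℕ → ℝ} {c : ℝ}
    (hu : Tendsto (fun n => (u n - d₀) / (2 * halfWidth p K γ n)) atTop (𝓝 c))
    (he' : Tendsto (fun n => (mean fun i : Fin (secondSize p n) => e' n i) / halfWidth p K γ n)
      atTop (𝓝 0)) :
    Tendsto (fun n => ((mean fun i : Fin (secondSize p n) => f (u n) + e' n i) - f d₀) /
      (2 * halfWidth p K γ n)) atTop (𝓝 (deriv f d₀ * c)) := by
  refine tendsto_mean_const_add_sub_div (y := fun n (i : Fin (secondSize p n)) => e' n i)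
    (tendsto_secondSize hp) hf.hasDerivAt ?_ ?_ hu ?_
  · simpa only [mul_zero] using (tendsto_halfWidth hp.1 hγ).const_mul 2
  · exact (eventually_halfWidth_pos hp.1 hK).mono fun n hn => (mul_pos two_pos hn).ne'
  · simpa only [zero_div, div_div, mul_comm (2 : ℝ)] using he'.div_const 2

end SamplingPoints

theorem limitScale_ne_zero {f : ℝ → ℝ} {d₀ p σ : ℝ} (hf : deriv f d₀ ≠ 0) (hp : p < 1)
    (hσ : σ ≠ 0) : limitScale f d₀ p σ ≠ 0 :=
  div_ne_zero hσ (mul_ne_zero hf (Real.sqrt_pos.2 (sub_pos.2 hp)).ne')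

theorem limitScale_sq {f : ℝ → ℝ} {d₀ p : ℝ} (hp : p < 1) (σ : ℝ) :
    limitScale f d₀ p σ ^ 2 = 2 / (1 - p) * σ ^ 2 / (2 * deriv f d₀ ^ 2) := by
  rw [limitScale, div_pow, mul_pow, Real.sq_sqrt (sub_pos.2 hp).le]
  have : 1 - p ≠ 0 := (sub_pos.2 hp).ne'
  field_simp

theorem tendsto_sqrt_sq_div_secondSize {p : ℝ} (hp : p ∈ Ioo (0 : ℝ) 1) :
    Tendsto (fun n : ℕ => √n ^ 2 / secondSize p n) atTop (𝓝 (2 / (1 - p))) := by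
  have h := (tendsto_secondSize_div hp).inv₀ (div_pos (sub_pos.2 hp.2) two_pos).ne'
  simpa only [inv_div, Real.sq_sqrt (Nat.cast_nonneg _)] using h

theorem tendstoInDistribution_bootstrapRoot {f : ℝ → ℝ} {d₀ p K γ σ κ : ℝ}
    {x : (m : ℕ) → Fin m → ℝ} {e : ℕ → ℕ → ℝ} {E : Fin 2 → ℕ → ℕ → ℝ} (hp : p ∈ Ioo (0 : ℝ) 1)
    (hK : 0 < K) (hγ0 : 0 < γ) (hγ : γ < 1 / 2) (hf : DifferentiableAt ℝ f d₀)
    (hb : 0 < deriv f d₀)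
    (hd : Tendsto (fun n : ℕ => (n : ℝ) ^ γ * (firstEstimate f d₀ p x n (e n) - d₀)) atTop (𝓝 0))
    (hmean : ∀ j, Tendsto (fun n : ℕ => (n : ℝ) ^ γ *
      mean fun i : Fin (secondSize p n) => E j n i) atTop (𝓝 0))
    (hsq : ∀ j, Tendsto (fun n => mean fun i : Fin (secondSize p n) => E j n i ^ 2) atTop
      (𝓝 (σ ^ 2)))
    (hcube : ∀ j, Tendsto (fun n => mean fun i : Fin (secondSize p n) => |E j n i| ^ 3) atTop
      (𝓝 κ)) :
    TendstoInDistribution (fun n => bootstrapRoot f d₀ p K γ x n (e n) (E 0 n) (E 1 n)) atTop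
      (fun z : ℝ => limitScale f d₀ p σ * z) (fun n => bootstrapMeasure (secondSize p n))
      (gaussianReal 0 1) := by
  have hk := tendsto_secondSize hp
  have hs := tendsto_sqrt_sq_div_secondSize hp
  have hd' := tendsto_div_halfWidth hp hK hγ0.le hd
  have hmean' (j) := tendsto_div_halfWidth hp hK hγ0.le (hmean j)
  have hmean0 (j) := tendsto_of_tendsto_div_halfWidth hp.1 hK hγ0 (hmean' j)
  set u : ℕ → Fin 2 → ℝ := fun n =>
    ![lowerPoint f d₀ p K γ x n (e n), upperPoint f d₀ p K γ x n (e n)]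
  refine tendstoInDistribution_bootstrap_lsInverse (s := fun n => √n)
    (Y := fun n j i => f (u n j) + E j n i) hk ?_ ?_ hb ?_ ?_ (fun j => ?_) (fun j => ?_)
    (limitScale_sq hp.2 σ)
  · filter_upwards [eventually_halfWidth_pos hp.1 hK] with n hn
    rw [← sub_pos, upperPoint_sub_lowerPoint]
    exact mul_pos two_pos hn
  · simp only [upperPoint_sub_lowerPoint, mul_left_comm _ (2 : ℝ)]
    exact (tendsto_sqrt_mul_halfWidth hp hK hγ0.le hγ).const_mul_atTop two_pos
  · simp only [upperPoint_sub_lowerPoint, show -(deriv f d₀ / 2) = deriv f d₀ * -(1 / 2) by ring]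
    exact tendsto_mean_add_sub_div_halfWidth hp hK hγ0 hf
      (tendsto_lowerPoint_sub_div hp.1 hK hd') (hmean' 0)
  · simp only [upperPoint_sub_lowerPoint, ← mul_one_div (deriv f d₀)]
    exact tendsto_mean_add_sub_div_halfWidth hp hK hγ0 hf
      (tendsto_upperPoint_sub_div hp.1 hK hd') (hmean' 1)
  · simpa only [zero_pow two_ne_zero, sub_zero] using
      tendsto_sum_scaledDeviation_const_add_sq _ hk hs (hmean0 j) (hsq j)
  · exact tendsto_sum_abs_scaledDeviation_const_add_cube _ hk hs (hmean0 j) (hcube j)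

theorem IsIIDArray.ae_tendsto_mean_secondSize {Ω : Type*} [MeasurableSpace Ω] {P : Measure Ω}
    [IsProbabilityMeasure P] {μ : Measure ℝ} [IsProbabilityMeasure μ] {e : ℕ → ℕ → Ω → ℝ}
    (he : IsIIDArray P μ e) (hmom : HasAllMoments μ) (hmean : ∫ z, z ∂μ = 0) {p γ : ℝ}
    (hp : p ∈ Ioo (0 : ℝ) 1) (hγ : γ < 1 / 2) :
    ∀ᵐ ω ∂P,
      Tendsto (fun n : ℕ => (n : ℝ) ^ γ * mean fun i : Fin (secondSize p n) => e n i ω) atTop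
        (𝓝 0) ∧
      Tendsto (fun n => mean fun i : Fin (secondSize p n) => e n i ω ^ 2) atTop
        (𝓝 (∫ z, z ^ 2 ∂μ)) ∧
      Tendsto (fun n => mean fun i : Fin (secondSize p n) => |e n i ω| ^ 3) atTop
        (𝓝 (∫ z, |z| ^ 3 ∂μ)) := by
  have hle : ∀ᶠ n in atTop, secondSize p n ≤ n := Eventually.of_forall (secondSize_le p)
  have hc : 0 < (1 - p) / 4 := by linarith [hp.2]
  have hge := eventually_mul_le_secondSize hp
  exact (he.ae_tendsto_rpow_mul_mean hle hc hge measurable_id hmom hmean hγ).and <|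
    (he.ae_tendsto_mean hle hc hge (φ := fun z => z ^ 2) (by fun_prop) fun r => by
      simpa only [abs_pow, ← pow_mul] using hmom (2 * r)).and <|
    he.ae_tendsto_mean hle hc hge (φ := fun z => |z| ^ 3) (by fun_prop) fun r => by
      simpa only [abs_pow, abs_abs, ← pow_mul] using hmom (3 * r)

theorem nullSingletonClass_map_const_mul_gaussianReal {c : ℝ} (hc : c ≠ 0) :
    NullSingletonClass ((gaussianReal 0 1).map fun z => c * z) := by
  rw [gaussianReal_map_const_mul]
  exact nullSingletonClass_gaussianReal
    (mul_ne_zero (fun h => pow_ne_zero 2 hc (congrArg NNReal.toReal h)) one_ne_zero)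

end TwoStage

theorem theorem3_general
    {Ω : Type*} [MeasurableSpace Ω] (P : Measure Ω) [IsProbabilityMeasure P]
    (f : ℝ → ℝ) (d₀ p K γ σ a : ℝ) (x : (m : ℕ) → Fin m → ℝ)
    (μ : Measure ℝ) [IsProbabilityMeasure μ] (ε ε' ε'' : ℕ → ℕ → Ω → ℝ)
    (hd₀ : d₀ ∈ Ioo (0 : ℝ) 1) (hp : p ∈ Ioo (0 : ℝ) 1) (hK : 0 < K)
    (hγ : γ ∈ Ioo (0 : ℝ) (1 / 3))
    (hmean : ∫ z, z ∂μ = 0) (hvar : ∫ z, z ^ 2 ∂μ = σ ^ 2) (hσ : σ ≠ 0)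
    (hmom : TwoStage.HasAllMoments μ) (hε : TwoStage.IsErrorArray P μ ε ε' ε'')
    (hf : DifferentiableAt ℝ f d₀) (hslope : TwoStage.HasSlopeAtLeast f d₀ a) (ha : 0 < a)
    (hmono : ∀ m, Monotone (x m)) (hx01 : ∀ m i, x m i ∈ Icc (0 : ℝ) 1)
    (hx : TwoStage.HasLowerDensity x) :
    ∀ᵐ ω ∂P,
      TendstoInDistribution
        (fun n => TwoStage.bootstrapRoot f d₀ p K γ x n
          (fun i => ε n i ω) (fun i => ε' n i ω) (fun i => ε'' n i ω))
        atTop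
        (fun z : ℝ => TwoStage.limitScale f d₀ p σ * z)
        (fun n => TwoStage.bootstrapMeasure (TwoStage.secondSize p n))
        (gaussianReal 0 1) ∧
      Tendsto
        (fun n : ℕ => ⨆ t : ℝ,
          |(TwoStage.bootstrapMeasure (TwoStage.secondSize p n)).real
              {r | TwoStage.bootstrapRoot f d₀ p K γ x n
                (fun i => ε n i ω) (fun i => ε' n i ω) (fun i => ε'' n i ω) r ≤ t}
            - (gaussianReal 0 1).real {z : ℝ | TwoStage.limitScale f d₀ p σ * z ≤ t}|)
        atTop (𝓝 0) := by
  obtain ⟨h0, h1, h2⟩ := hε.isIIDArray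
  have hb : 0 < deriv f d₀ := ha.trans_le (hslope.le_deriv hd₀ hf)
  have hγ' : γ < 1 / 2 := hγ.2.trans (by norm_num)
  have := TwoStage.nullSingletonClass_map_const_mul_gaussianReal
    (TwoStage.limitScale_ne_zero hb.ne' hp.2 hσ)
  filter_upwards [h0.ae_tendsto_firstEstimate hmom hmean hslope ha hd₀ hmono hx01 hx hp hγ,
    h1.ae_tendsto_mean_secondSize hmom hmean hp hγ',
    h2.ae_tendsto_mean_secondSize hmom hmean hp hγ']
    with ω hd ⟨hmean', hsq', hcube'⟩ ⟨hmean'', hsq'', hcube''⟩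
  rw [hvar] at hsq' hsq''
  have hdist := TwoStage.tendstoInDistribution_bootstrapRoot
    (E := ![fun n i => ε' n i ω, fun n i => ε'' n i ω]) hp hK hγ.1 hγ' hf hb hd
    (Fin.forall_fin_two.2 ⟨hmean', hmean''⟩) (Fin.forall_fin_two.2 ⟨hsq', hsq''⟩)
    (Fin.forall_fin_two.2 ⟨hcube', hcube''⟩)
  exact ⟨hdist, TwoStage.tendsto_iSup_abs_sub_of_tendstoInDistribution hdist⟩

theorem theorem3
    {Ω : Type*} [MeasurableSpace Ω] (P : Measure Ω) [IsProbabilityMeasure P]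
    (f : ℝ → ℝ) (d₀ p K γ σ : ℝ) (x : (m : ℕ) → Fin m → ℝ)
    (μ : Measure ℝ) (ε ε' ε'' : ℕ → ℕ → Ω → ℝ)
    (hd₀ : d₀ ∈ Ioo (0 : ℝ) 1) (hp : p ∈ Ioo (0 : ℝ) 1) (hK : 0 < K)
    (hγ : γ ∈ Ioo (0 : ℝ) (1 / 3))
    (hμ : TwoStage.IsErrorLaw μ σ) (hε : TwoStage.IsErrorArray P μ ε ε' ε'')
    (hf : TwoStage.InClassF f d₀)
    (hx : TwoStage.IsDesignArray x) (hxG : TwoStage.IsRegularDesign x)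
    (hf' : TwoStage.HasBoundedSlope f)
    (hmom : TwoStage.HasAllMoments μ) :
    ∀ᵐ ω ∂P,
      TendstoInDistribution
        (fun n => TwoStage.bootstrapRoot f d₀ p K γ x n
          (fun i => ε n i ω) (fun i => ε' n i ω) (fun i => ε'' n i ω))
        atTop
        (fun z : ℝ => TwoStage.limitScale f d₀ p σ * z)
        (fun n => TwoStage.bootstrapMeasure (TwoStage.secondSize p n))
        (gaussianReal 0 1) ∧
      Tendsto
        (fun n : ℕ => ⨆ t : ℝ,
          |(TwoStage.bootstrapMeasure (TwoStage.secondSize p n)).real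
              {r | TwoStage.bootstrapRoot f d₀ p K γ x n
                (fun i => ε n i ω) (fun i => ε' n i ω) (fun i => ε'' n i ω) r ≤ t}
            - (gaussianReal 0 1).real {z : ℝ | TwoStage.limitScale f d₀ p σ * z ≤ t}|)
        atTop (𝓝 0) := by
  have := hμ.isProbabilityMeasure
  obtain ⟨a, ha, hslope⟩ := hf'.exists_hasSlopeAtLeast (Ioo_subset_Icc_self hd₀)
  exact theorem3_general P f d₀ p K γ σ a x μ ε ε' ε'' hd₀ hp hK hγ hμ.mean_eq hμ.var_eq hμ.pos.ne'
    hmom hε (hf'.1.differentiableAt (Icc_mem_nhds hd₀.1 hd₀.2)) hslope ha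
    (fun m => (hx m).1.monotone) (fun m => (hx m).2) hxG.hasLowerDensity
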